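/- Let $f:(0,\infty)\to\mathbb R$ be a $C^\infty$ function with $f(s)f'(s)\neq 0$ for all $s>0$. **The flow.** On $\mathbb C\setminus\{0\}$ consider the equation $\dot z = i z f(|z|)-i$. A *trajectory* is a continuous map $z:\mathbb R\to\mathbb C$ which satisfies this equation at every time $t$ with $z(t)\ne 0$ and which vanishes identically on no non-empty open interval. Let $\Phi_f(\cdot,p)$ be the trajectory with $z(0)=p$; if there is none through $p=0$, put $\Phi_f(t,0)=0$ for all $t$. Let $\mathcal F_f=\{z\in\mathbb C\setminus\{0\}: z f(|z|)=1\}\subset\mathbb R$. A point $p$ is *periodic* if $\Phi_f(t,p)=p$ for some $t>0$; then $T_f(p)\ge 0$ denotes the infimum of all such $t$. The orbit of a periodic point $p$ is *untwisted* if $0$ lies in the exterior of $\Phi_f(\mathbb R,p)$, i.e. in the unbounded connected component of $\mathbb C\setminus\Phi_f(\mathbb R,p)$. The *net winding* of $p$ is $\omega_f(p)=\pm\frac1{2\pi}\int_0^{T_f(p)} f(|\Phi_f(t,p)|)\,dt$, with $+$ (respectively, $-$) if the closed path $\Phi_f(\cdot,p)$ is oriented counter-clockwise (respectively, clockwise);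 it is $0$ if $T_f(p)=0$. **The curves.** An *oriented smooth curve* $\mathcal C$ is a $C^\infty$ path $c:J\to\mathbb C$ parametrized by arc length, where $J\ni 0$ is an open interval, up to translation of the parameter; $[\mathcal C]=c(J)$. With $\dot c=e^{i\vartheta}$, its curvature is $\kappa=\dot\vartheta$. The curve is a *solution* of $\kappa=f(r)$ if $\kappa(t)=f(|c(t)|)$ for all $t\in J$ with $c(t)\neq0$. A solution $\mathcal C$ is *maximal* if $[\mathcal C]\subset[\widehat{\mathcal C}]$ for a solution $\widehat{\mathcal C}$ implies $[\mathcal C]=[\widehat{\mathcal C}]$. It is *closed* if $[\mathcal C]$ is compact, and a *Jordan solution* is a maximal solution for which $[\mathcal C]$ is homeomorphic to the unit circle. Put $z_c(t)=-i\,\overline{c(t)}\,\dot c(t)$. A closed maximal solution $\mathcal C$ is called untwisted if the orbit of $z_c(0)$ is, and $\omega_f(\mathcal C)=\omega_f(z_c(0))$ (for any parametrization $c$ of $\mathcal C$). **Theorem.** For every closed maximal solution $\mathcal C$ of $\kappa=f(r)$ the following are equivalent: 1. $\mathcal C$ is untwisted, and $\omega_f(\mathcal C)=0$ or $\omega_f(\mathcal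 C)=1/n$ for some integer $n\ge 2$; 2. $\mathcal C$ is a Jordan solution. Moreover, $\omega_f(\mathcal C)=0$ if and only if, for some $z\in\mathcal F_f$, $\mathcal C$ is a circle of radius $|z|$ centered at $0$, oriented counter-clockwise when $z>0$ and clockwise when $z<0$. -/

import Mathlib

open scoped ContDiff

noncomputable section

namespace RadialCurvature

/-! ### The planar flow attached to `κ = f(r)` -/

/-- The vector field `i z f(|z|) - i` (only its values at `z ≠ 0` are meaningful). -/
def field (f : ℝ → ℝ) (z : ℂ) : ℂ := Complex.I * z * (f ‖z‖ : ℂ) - Complex.I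

/-- A global trajectory in `ℂ` of `ż = i z f(|z|) - i`: the equation, which is posed on `ℂ ∖ {0}`,
holds at every time at which `z` is not `0`; the trajectory may run through the origin, but it does
not rest there. -/
structure IsTrajectory (f : ℝ → ℝ) (z : ℝ → ℂ) : Prop where
  continuous : Continuous z
  ode : ∀ t, z t ≠ 0 → HasDerivAt z (field f (z t)) t
  dense : Dense {t | z t ≠ 0}

open Classical in
/-- `flow f t p = Φ_f(t, p)`: move for time `t` along the trajectory that starts at `p`.
For smooth `f` there is exactly one trajectory through each `p ≠ 0`. There is at most one through
the origin, and if there is none, then the origin is a fixed point. -/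
def flow (f : ℝ → ℝ) (t : ℝ) (p : ℂ) : ℂ :=
  if h : ∃ z : ℝ → ℂ, IsTrajectory f z ∧ z 0 = p then h.choose t else p

/-- `Φ` is a topological flow on `ℂ` generated by `ż = i z f(|z|) - i` on `ℂ ∖ {0}`. -/
structure IsTopologicalFlow (f : ℝ → ℝ) (Φ : ℝ → ℂ → ℂ) : Prop where
  continuous : Continuous fun q : ℝ × ℂ => Φ q.1 q.2
  zero : ∀ p, Φ 0 p = p
  add : ∀ s t p, Φ (s + t) p = Φ s (Φ t p)
  ode : ∀ t p, Φ t p ≠ 0 → HasDerivAt (fun u => Φ u p) (field f (Φ t p)) t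

/-- Compatibility of the two notions: whenever the equation generates a topological flow on `ℂ`,
the motion of every point under that flow is a trajectory, except for the origin in case the
origin is fixed. -/
theorem IsTopologicalFlow.isTrajectory {f : ℝ → ℝ} {Φ : ℝ → ℂ → ℂ} (h : IsTopologicalFlow f Φ)
    (p : ℂ) (hp : p ≠ 0 ∨ ∃ t, Φ t 0 ≠ 0) : IsTrajectory f (fun t => Φ t p) := by
  have hfix : (∃ t, Φ t p = 0) → (∀ t, Φ t 0 = 0) → p = 0 := by
    rintro ⟨t, ht⟩ h0
    have := h.add (-t) t p
    rw [ht, h0, neg_add_cancel, h.zero] at this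
    exact this
  refine ⟨h.continuous.comp (by fun_prop : Continuous fun t : ℝ => (t, p)), fun t => h.ode t p, ?_⟩
  by_contra hd
  rw [dense_iff_closure_eq, ← Ne, Set.ne_univ_iff_exists_notMem] at hd
  obtain ⟨a, ha⟩ := hd
  rw [Metric.mem_closure_iff] at ha
  push Not at ha
  obtain ⟨ε, hε, ha⟩ := ha
  have hz : ∀ b, |b - a| < ε → Φ b p = 0 := by
    intro b hb
    by_contra hne
    have := ha b hne
    rw [dist_comm, Real.dist_eq] at this
    linarith
  have hpa : Φ a p = 0 := hz a (by simpa using hε)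
  have hsmall : ∀ s, |s| < ε → Φ s 0 = 0 := by
    intro s hs
    have := h.add s a p
    rw [hpa] at this
    rw [← this]
    exact hz _ (by simpa using hs)
  have hmul : ∀ (n : ℕ) (s : ℝ), |s| < ε → Φ (n * s) 0 = 0 := by
    intro n s hs
    induction n with
    | zero => simpa using h.zero 0
    | succ k ih =>
      have : ((k + 1 : ℕ) : ℝ) * s = s + k * s := by push_cast; ring
      rw [this, h.add, ih, hsmall s hs]
  have hall : ∀ t, Φ t 0 = 0 := by
    intro t
    obtain ⟨n, hn⟩ := exists_nat_gt (|t| / ε)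
    have hn0 : (0 : ℝ) < n := lt_of_le_of_lt (by positivity) hn
    have h1 : |t / n| < ε := by
      rw [abs_div, abs_of_pos hn0, div_lt_iff₀ hn0]
      rw [div_lt_iff₀ hε] at hn
      linarith
    have := hmul n (t / n) h1
    rwa [mul_div_cancel₀ _ hn0.ne'] at this
  rcases hp with hp | ⟨t, ht⟩
  · exact hp (hfix ⟨a, hpa⟩ hall)
  · exact ht (hall t)

/-- The orbit `Φ_f(ℝ, p)`. -/
def orbit (f : ℝ → ℝ) (p : ℂ) : Set ℂ := Set.range fun t => flow f t p

/-- `Per Φ_f` (fixed points included). -/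
def Per (f : ℝ → ℝ) : Set ℂ := {p | ∃ t : ℝ, 0 < t ∧ flow f t p = p}

/-- The minimal period `T_f(p)` of `p ∈ Per Φ_f`; it is `0` for a fixed point. -/
def period (f : ℝ → ℝ) (p : ℂ) : ℝ := sInf {t : ℝ | 0 < t ∧ flow f t p = p}

/-- The set `F_f` of all `z ≠ 0` with `z f(|z|) = 1`; it is a subset of the real axis. -/
def fixedSet (f : ℝ → ℝ) : Set ℂ := {z | z ≠ 0 ∧ z * (f ‖z‖ : ℂ) = 1}

/-- The orbit of `p` is untwisted: it is periodic and the origin lies in its exterior, that is,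
in the unbounded component of the complement of the orbit. (If the origin is on the orbit, then
`connectedComponentIn` is empty, so the orbit is not untwisted.) -/
def Untwisted (f : ℝ → ℝ) (p : ℂ) : Prop :=
  p ∈ Per f ∧ ¬ Bornology.IsBounded (connectedComponentIn (orbit f p)ᶜ 0)

/-- The signed area `½ ∮ (x dy - y dx)` enclosed by the closed path `Φ_f(·, p)`. -/
def signedArea (f : ℝ → ℝ) (p : ℂ) : ℝ :=
  (1 / 2) * ∫ t in (0 : ℝ)..period f p,
    (starRingEnd ℂ (flow f t p) * deriv (fun u => flow f u p) t).im

/-- The net winding `ω_f(p) = ± (1 / 2π) ∫ f(|Φ_f(t, p)|) dt` over one minimal period, with the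
plus sign if the simple closed path `Φ_f(·, p)` is oriented counter-clockwise (positive signed area)
and the minus sign if it is oriented clockwise (negative signed area). For a fixed point the
integral is `0`. -/
def netWinding (f : ℝ → ℝ) (p : ℂ) : ℝ :=
  Real.sign (signedArea f p) *
    ((1 / (2 * Real.pi)) * ∫ t in (0 : ℝ)..period f p, f ‖flow f t p‖)

/-! ### Plane curves -/

/-- A smooth path parametrized by arc length on an open interval `J ∋ 0`. The values of `toFun`
off `J` play no role. An oriented smooth curve is such a path up to a shift of the parameter. -/
structure UnitSpeedPath where
  J : Set ℝ
  toFun : ℝ → ℂ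
  isOpen_J : IsOpen J
  ordConnected_J : J.OrdConnected
  zero_mem : (0 : ℝ) ∈ J
  smooth : ContDiffOn ℝ ∞ toFun J
  unit_speed : ∀ t ∈ J, ‖deriv toFun t‖ = 1

namespace UnitSpeedPath

/-- The set `[C]` of points of the curve. -/
def trace (c : UnitSpeedPath) : Set ℂ := c.toFun '' c.J

/-- The signed curvature `det(ċ, c̈)`. -/
def curvature (c : UnitSpeedPath) (t : ℝ) : ℝ :=
  (starRingEnd ℂ (deriv c.toFun t) * deriv (deriv c.toFun) t).im

/-- The curvature is the derivative of the tangent angle `ϑ`, where `ċ = exp(iϑ)`. -/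
theorem curvature_eq_deriv_angle (c : UnitSpeedPath) (ϑ : ℝ → ℝ)
    (hϑ : ∀ t ∈ c.J, DifferentiableAt ℝ ϑ t)
    (hc : ∀ t ∈ c.J, deriv c.toFun t = Complex.exp (Complex.I * ϑ t)) {t : ℝ} (ht : t ∈ c.J) :
    c.curvature t = deriv ϑ t := by
  have h1 : deriv c.toFun =ᶠ[nhds t] fun s => Complex.exp (Complex.I * ϑ s) := by
    filter_upwards [c.isOpen_J.mem_nhds ht] with s hs using hc s hs
  have h2 : HasDerivAt (fun s => Complex.exp (Complex.I * ϑ s))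
      (Complex.exp (Complex.I * ϑ t) * (Complex.I * (deriv ϑ t : ℝ))) t :=
    ((hϑ t ht).hasDerivAt.ofReal_comp.const_mul Complex.I).cexp
  have h3 : starRingEnd ℂ (Complex.exp (Complex.I * ϑ t)) * Complex.exp (Complex.I * ϑ t) = 1 := by
    rw [← Complex.exp_conj, ← Complex.exp_add]
    simp
  rw [curvature, h1.deriv_eq, h2.deriv, hc t ht, ← mul_assoc, h3]
  simp

/-- The path `z_c(t) = -i · conj(c(t)) · exp(iϑ(t))`, where `exp(iϑ) = ċ`. -/
def assoc (c : UnitSpeedPath) (t : ℝ) : ℂ :=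
  -Complex.I * starRingEnd ℂ (c.toFun t) * deriv c.toFun t

/-- `c` is a solution of `κ = f(r)`. -/
def IsSolution (f : ℝ → ℝ) (c : UnitSpeedPath) : Prop :=
  ∀ t ∈ c.J, c.toFun t ≠ 0 → c.curvature t = f ‖c.toFun t‖

/-- `c` is a maximal solution of `κ = f(r)`: no solution has a strictly larger trace. -/
def IsMaximalSolution (f : ℝ → ℝ) (c : UnitSpeedPath) : Prop :=
  c.IsSolution f ∧ ∀ d : UnitSpeedPath, d.IsSolution f → c.trace ⊆ d.trace → c.trace = d.trace

/-- The curve is closed. -/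
def IsClosedCurve (c : UnitSpeedPath) : Prop := IsCompact c.trace

/-- The curve is simple closed: its trace is homeomorphic to the unit circle. -/
def IsSimpleClosed (c : UnitSpeedPath) : Prop := Nonempty (c.trace ≃ₜ Circle)

/-- A Jordan solution is a maximal solution that is simple closed. -/
def IsJordanSolution (f : ℝ → ℝ) (c : UnitSpeedPath) : Prop :=
  c.IsMaximalSolution f ∧ c.IsSimpleClosed

/-- `c` runs counter-clockwise around the origin. -/
def IsCounterClockwise (c : UnitSpeedPath) : Prop :=
  ∀ t ∈ c.J, 0 < (starRingEnd ℂ (c.toFun t) * deriv c.toFun t).im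

/-- `c` runs clockwise around the origin. -/
def IsClockwise (c : UnitSpeedPath) : Prop :=
  ∀ t ∈ c.J, (starRingEnd ℂ (c.toFun t) * deriv c.toFun t).im < 0

end UnitSpeedPath

end RadialCurvature

end

/-!
A closed solution is described by its momentum `z = -i · conj(c) · ċ`, an integral curve of
`ż = i z f(|z|) - i`, from which the curve is recovered by `c = -i · conj(z) · ċ`. Reflection in the
real axis together with time reversal preserves this equation. The distance `r` from the origin is
critical exactly when `z` is real, so the curve is symmetric about all such times.

Since the trace is compact, `r` attains its maximum and its minimum on it. If they agree, `z` is a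
fixed point and the curve is a circle centred at the origin. Otherwise there are two consecutive
critical times `a < a + τ`, and reflecting the arc between them over and over again extends the
curve to the whole line (`IsSolution.exists_oscillating_extension`); by maximality the trace does
not grow. Smoothness of the extension and the identification of the flow rest on the uniqueness of
integral curves. It holds at the origin as well, because a smooth solution passing through the
origin forces `f` to be Lipschitz near `0` (`lipNear_field_zero_of_passage`). The momentum has
minimal period `2τ`, and since its signed area is `∮ κ y² dt`, the net winding is `β / π`, where
`β > 0` is the absolute value of the turning of the tangent over the half-period `[a, a + τ]`. In
particular it vanishes for fixed points only. Taking a mirror image if `f < 0`, one may assume that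
`κ > 0` away from the origin.

If `n β = π`, the curve closes up with total turning `2π`, hence is convex and simple
(`range_homeomorph_circle_of_turning`). Conversely, let the trace be a topological circle. Then
branches that meet are tangent (`IsArc.tangent_eq_or_eq_neg`), whereas a branch and its mirror image
in a symmetry axis meet transversally wherever the branch hits that axis at a non-critical time and
is not radial (`IsOscillating.false_of_polarAngle_eq`). Tracking the polar angle over a half-period,
one finds such a crossing unless the momentum stays in the right half-plane and `β = π / n`. The
borderline case `β = π` is excluded by the argument of the four-vertex theorem
(`IsConvexOscillating.tangentAngle_half_ne_pi`), and this is where the monotonicity of `f` enters.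
A momentum in the right half-plane has an untwisted orbit.
-/

noncomputable section

namespace RadialCurvature

open Complex Set Filter Topology MeasureTheory

/-! ### Real and imaginary parts of derivatives -/

theorem hasDerivAt_re {z : ℝ → ℂ} {z' : ℂ} {t : ℝ} (h : HasDerivAt z z' t) :
    HasDerivAt (fun s => (z s).re) z'.re t :=
  Complex.reCLM.hasFDerivAt.comp_hasDerivAt t h

theorem hasDerivAt_im {z : ℝ → ℂ} {z' : ℂ} {t : ℝ} (h : HasDerivAt z z' t) :
    HasDerivAt (fun s => (z s).im) z'.im t :=
  Complex.imCLM.hasFDerivAt.comp_hasDerivAt t h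

theorem hasDerivAt_conj {z : ℝ → ℂ} {z' : ℂ} {t : ℝ} (h : HasDerivAt z z' t) :
    HasDerivAt (fun s => starRingEnd ℂ (z s)) (starRingEnd ℂ z') t :=
  Complex.conjCLE.toContinuousLinearMap.hasFDerivAt.comp_hasDerivAt t h

/-! ### Uniqueness for the differential equations -/

/-- Two continuous paths that agree once, and that agree near every time at which they meet, agree
throughout. -/
theorem eqOn_of_eventuallyEq_of_eq {z₁ z₂ : ℝ → ℂ} {s : Set ℝ} (hs : IsPreconnected s)
    (h₁ : ∀ t ∈ s, ContinuousAt z₁ t) (h₂ : ∀ t ∈ s, ContinuousAt z₂ t)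
    (hloc : ∀ t ∈ s, z₁ t = z₂ t → z₁ =ᶠ[𝓝 t] z₂) {a : ℝ} (ha : a ∈ s) (h : z₁ a = z₂ a) :
    EqOn z₁ z₂ s := by
  have hsub : s ⊆ {t | z₁ =ᶠ[𝓝 t] z₂} := by
    refine hs.subset_of_closure_inter_subset isOpen_setOfPred_eventually_nhds ⟨a, ha, hloc a ha h⟩ ?_
    rintro t ⟨htc, hts⟩
    refine hloc t hts ?_
    rw [mem_closure_iff_frequently] at htc
    by_contra hne
    have hev : ∀ᶠ x in 𝓝 t, z₁ x ≠ z₂ x := by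
      filter_upwards [((h₁ t hts).sub (h₂ t hts)).eventually_ne (sub_ne_zero.mpr hne)] with x hx
      exact sub_ne_zero.mp hx
    obtain ⟨x, hx, hx'⟩ := (htc.and_eventually hev).exists
    exact hx' hx.self_of_nhds
  exact fun t ht => (hsub ht).self_of_nhds

/-- Uniqueness for the linear equation `ż = i κ(t) z + β` with real `κ`: the modulus of the
difference of two solutions is constant. -/
theorem eqOn_of_linear {κ : ℝ → ℝ} {β : ℂ} {z₁ z₂ : ℝ → ℂ} {s : Set ℝ} (hs : IsPreconnected s)
    (hso : IsOpen s) (h₁ : ∀ t ∈ s, HasDerivAt z₁ (I * κ t * z₁ t + β) t)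
    (h₂ : ∀ t ∈ s, HasDerivAt z₂ (I * κ t * z₂ t + β) t) {a : ℝ} (ha : a ∈ s)
    (h : z₁ a = z₂ a) : EqOn z₁ z₂ s := by
  have hd : ∀ t ∈ s, HasDerivAt (fun t => ‖z₁ t - z₂ t‖ ^ 2) 0 t := by
    intro t ht
    have := ((h₁ t ht).sub (h₂ t ht)).norm_sq
    convert this using 1
    simp only [Pi.sub_apply]
    simp
    ring
  intro t ht
  have := hso.is_const_of_deriv_eq_zero hs
    (fun x hx => (hd x hx).differentiableAt.differentiableWithinAt)
    (fun x hx => (hd x hx).deriv) ht ha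
  rw [h, sub_self, norm_zero] at this
  have h0 : ‖z₁ t - z₂ t‖ = 0 := by simpa using this
  exact sub_eq_zero.mp (norm_eq_zero.mp h0)

/-- The map `V` is Lipschitz in a neighbourhood of `p`. -/
def LipNear (V : ℂ → ℂ) (p : ℂ) : Prop := ∃ K, ∃ s ∈ 𝓝 p, LipschitzOnWith K V s

theorem LipNear.continuousAt {V : ℂ → ℂ} {p : ℂ} (h : LipNear V p) : ContinuousAt V p := by
  obtain ⟨K, s, hs, hK⟩ := h
  exact hK.continuousOn.continuousAt hs

theorem LipNear.eventuallyEq {V : ℂ → ℂ} {z₁ z₂ : ℝ → ℂ} {a : ℝ} (hL : LipNear V (z₁ a))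
    (h₁ : ∀ᶠ t in 𝓝 a, HasDerivAt z₁ (V (z₁ t)) t)
    (h₂ : ∀ᶠ t in 𝓝 a, HasDerivAt z₂ (V (z₂ t)) t) (h : z₁ a = z₂ a) : z₁ =ᶠ[𝓝 a] z₂ := by
  obtain ⟨K, s, hs, hK⟩ := hL
  refine ODE_solution_unique_of_eventually (v := fun _ => V) (s := fun _ => s) (K := K)
    (Eventually.of_forall fun _ => hK) ?_ ?_ h
  · exact h₁.and (h₁.self_of_nhds.continuousAt.eventually hs)
  · exact h₂.and (h₂.self_of_nhds.continuousAt.eventually (h ▸ hs))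

/-- Uniqueness of integral curves of a field that is locally Lipschitz along one of them. -/
theorem eqOn_of_integralCurve {V : ℂ → ℂ} {z₁ z₂ : ℝ → ℂ} {s : Set ℝ} (hs : IsPreconnected s)
    (hso : IsOpen s) (hL : ∀ t ∈ s, LipNear V (z₁ t))
    (h₁ : ∀ t ∈ s, HasDerivAt z₁ (V (z₁ t)) t) (h₂ : ∀ t ∈ s, HasDerivAt z₂ (V (z₂ t)) t)
    {a : ℝ} (ha : a ∈ s) (h : z₁ a = z₂ a) : EqOn z₁ z₂ s := by
  refine eqOn_of_eventuallyEq_of_eq hs (fun t ht => (h₁ t ht).continuousAt)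
    (fun t ht => (h₂ t ht).continuousAt) (fun t ht heq => (hL t ht).eventuallyEq ?_ ?_ heq) ha h
  · filter_upwards [hso.mem_nhds ht] with x hx using h₁ x hx
  · filter_upwards [hso.mem_nhds ht] with x hx using h₂ x hx

theorem exists_last_zero {E : Type*} [NormedAddCommGroup E] {g : ℝ → E} {a b : ℝ} (hab : a ≤ b)
    (hg : ContinuousOn g (Icc a b)) (ha : g a = 0) (hb : g b ≠ 0) :
    ∃ x ∈ Ico a b, g x = 0 ∧ ∀ t ∈ Ioc x b, g t ≠ 0 := by
  have hcl : IsClosed (Icc a b ∩ g ⁻¹' {0}) :=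
    hg.preimage_isClosed_of_isClosed isClosed_Icc isClosed_singleton
  have hcomp : IsCompact (Icc a b ∩ g ⁻¹' {0}) := isCompact_Icc.of_isClosed_subset hcl
    inter_subset_left
  obtain ⟨x, hx⟩ := hcomp.exists_isGreatest ⟨a, ⟨le_rfl, hab⟩, ha⟩
  have hxb : x ≠ b := by rintro rfl; exact hb hx.1.2
  refine ⟨x, ⟨hx.1.1.1, lt_of_le_of_ne hx.1.1.2 hxb⟩, hx.1.2, fun t ht h0 => ?_⟩
  exact absurd (hx.2 ⟨⟨hx.1.1.1.trans ht.1.le, ht.2⟩, h0⟩) (not_le.mpr ht.1)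

theorem exists_first_zero {E : Type*} [NormedAddCommGroup E] {g : ℝ → E} {a b : ℝ} (hab : a ≤ b)
    (hg : ContinuousOn g (Icc a b)) (ha : g a ≠ 0) (hb : g b = 0) :
    ∃ x ∈ Ioc a b, g x = 0 ∧ ∀ t ∈ Ico a x, g t ≠ 0 := by
  have hcl : IsClosed (Icc a b ∩ g ⁻¹' {0}) :=
    hg.preimage_isClosed_of_isClosed isClosed_Icc isClosed_singleton
  have hcomp : IsCompact (Icc a b ∩ g ⁻¹' {0}) := isCompact_Icc.of_isClosed_subset hcl
    inter_subset_left
  obtain ⟨x, hx⟩ := hcomp.exists_isLeast ⟨b, ⟨hab, le_rfl⟩, hb⟩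
  have hxa : x ≠ a := by rintro rfl; exact ha hx.1.2
  refine ⟨x, ⟨lt_of_le_of_ne hx.1.1.1 hxa.symm, hx.1.1.2⟩, hx.1.2, fun t ht h0 => ?_⟩
  exact absurd (hx.2 ⟨⟨ht.1, ht.2.le.trans hx.1.1.2⟩, h0⟩) (not_le.mpr ht.2)

@[simp] theorem field_zero (f : ℝ → ℝ) : field f 0 = -I := by simp [field]

/-- If the field is Lipschitz at the origin, a trajectory obeys the equation at its passages
through the origin as well. Near the origin the field is close to `-i`, so that two zeros of the
trajectory cannot follow each other within a short time. -/
theorem IsTrajectory.eventually_hasDerivAt {f : ℝ → ℝ} {z : ℝ → ℂ} (hz : IsTrajectory f z)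
    (hL : LipNear (field f) 0) {a : ℝ} (ha : z a = 0) :
    ∀ᶠ t in 𝓝 a, HasDerivAt z (field f (z t)) t := by
  have hc : ContinuousAt (fun t => field f (z t)) a := by
    refine ContinuousAt.comp (g := field f) ?_ hz.continuous.continuousAt
    rw [ha]; exact hL.continuousAt
  have hlt : ∀ᶠ t in 𝓝 a, (field f (z t)).im < 0 := by
    have h1 : ContinuousAt (fun t => (field f (z t)).im) a :=
      Complex.continuous_im.continuousAt.comp hc
    exact h1.eventually_lt continuousAt_const (by simp [ha])
  obtain ⟨ε, hε, hball⟩ := Metric.eventually_nhds_iff_ball.mp hlt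
  rw [Real.ball_eq_Ioo] at hball
  have key : ∀ t₁ t₂, t₁ ∈ Ioo (a - ε) (a + ε) → t₂ ∈ Ioo (a - ε) (a + ε) → t₁ < t₂ →
      z t₁ = 0 → z t₂ = 0 → False := by
    intro t₁ t₂ ht₁ ht₂ h12 hz1 hz2
    obtain ⟨t, ht, htz⟩ := hz.dense.exists_mem_open isOpen_Ioo (nonempty_Ioo.mpr h12)
    simp only [mem_ofPred_eq] at ht
    obtain ⟨A, hA, hA0, hA'⟩ := exists_last_zero htz.1.le hz.continuous.continuousOn hz1 ht
    obtain ⟨B, hB, hB0, hB'⟩ := exists_first_zero htz.2.le hz.continuous.continuousOn ht hz2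
    have hne : ∀ s ∈ Ioo A B, z s ≠ 0 := by
      intro s hs
      rcases le_total s t with h | h
      · exact hA' s ⟨hs.1, h⟩
      · exact hB' s ⟨h, hs.2⟩
    obtain ⟨s, hs, hs'⟩ := exists_hasDerivAt_eq_slope (fun t => (z t).im)
      (fun t => (field f (z t)).im) (hA.2.trans hB.1)
      (Complex.continuous_im.comp hz.continuous).continuousOn
      (fun s hs => hasDerivAt_im (hz.ode s (hne s hs)))
    have hsI : s ∈ Ioo (a - ε) (a + ε) :=
      ⟨ht₁.1.trans_le (hA.1.trans hs.1.le), (hs.2.trans_le hB.2).trans ht₂.2⟩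
    have := hball s hsI
    simp [hA0, hB0] at hs'
    linarith
  have hz0 : ∀ t ∈ Ioo (a - ε) (a + ε), t ≠ a → z t ≠ 0 := by
    intro t ht hta h0
    have haI : a ∈ Ioo (a - ε) (a + ε) := ⟨by linarith, by linarith⟩
    rcases lt_or_gt_of_ne hta with h | h
    · exact key t a ht haI h h0 ha
    · exact key a t haI ht h ha h0
  have hda : HasDerivAt z (field f (z a)) a := by
    have hz0' : ∀ᶠ t in 𝓝 a, t ≠ a → z t ≠ 0 := by
      filter_upwards [Ioo_mem_nhds (by linarith : a - ε < a) (by linarith : a < a + ε)] with t ht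
      exact hz0 t ht
    have hI : Ioo (a - ε) (a + ε) ∈ 𝓝 a :=
      Ioo_mem_nhds (by linarith : a - ε < a) (by linarith : a < a + ε)
    have hr : HasDerivWithinAt z (field f (z a)) (Ici a) a := by
      refine hasDerivWithinAt_Ici_of_tendsto_deriv (s := Ioo a (a + ε))
        (fun t ht => (hz.ode t (hz0 t ⟨by linarith [ht.1], ht.2⟩
          ht.1.ne')).differentiableAt.differentiableWithinAt)
        hz.continuous.continuousWithinAt (Ioo_mem_nhdsGT (by linarith)) ?_
      refine (hc.tendsto.mono_left nhdsWithin_le_nhds).congr' ?_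
      filter_upwards [Ioo_mem_nhdsGT (by linarith : a < a + ε)] with t ht
      exact (hz.ode t (hz0 t ⟨by linarith [ht.1], ht.2⟩ ht.1.ne')).deriv.symm
    have hl : HasDerivWithinAt z (field f (z a)) (Iic a) a := by
      refine hasDerivWithinAt_Iic_of_tendsto_deriv (s := Ioo (a - ε) a)
        (fun t ht => (hz.ode t (hz0 t ⟨ht.1, by linarith [ht.2]⟩
          ht.2.ne)).differentiableAt.differentiableWithinAt)
        hz.continuous.continuousWithinAt (Ioo_mem_nhdsLT (by linarith)) ?_
      refine (hc.tendsto.mono_left nhdsWithin_le_nhds).congr' ?_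
      filter_upwards [Ioo_mem_nhdsLT (by linarith : a - ε < a)] with t ht
      exact (hz.ode t (hz0 t ⟨ht.1, by linarith [ht.2]⟩ ht.2.ne)).deriv.symm
    simpa using hl.union hr
  filter_upwards [Ioo_mem_nhds (by linarith : a - ε < a) (by linarith : a < a + ε)] with t ht
  by_cases h : t = a
  · rw [h]; exact hda
  · exact hz.ode t (hz0 t ht h)

/-- A global integral curve of `field f` along which the field is locally Lipschitz is the only
trajectory through its initial point. -/
theorem IsTrajectory.eq_of_integralCurve {f : ℝ → ℝ} {z₁ z₂ : ℝ → ℂ}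
    (h₁ : ∀ t, HasDerivAt z₁ (field f (z₁ t)) t) (hL : ∀ t, LipNear (field f) (z₁ t))
    (h₂ : IsTrajectory f z₂) {a : ℝ} (h : z₁ a = z₂ a) : z₁ = z₂ := by
  have := eqOn_of_eventuallyEq_of_eq isPreconnected_univ (fun t _ => (h₁ t).continuousAt)
    (fun t _ => h₂.continuous.continuousAt) (fun t _ heq => (hL t).eventuallyEq
      (Eventually.of_forall h₁) ?_ heq) (mem_univ a) h
  · exact funext fun t => this (mem_univ t)
  · by_cases h0 : z₂ t = 0
    · refine h₂.eventually_hasDerivAt ?_ h0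
      rw [← h0, ← heq]; exact hL t
    · filter_upwards [h₂.continuous.continuousAt.eventually_ne h0] with s hs using h₂.ode s hs

/-- The flow moves a point along any integral curve through it along which the field is locally
Lipschitz and which is a trajectory. -/
theorem flow_eq_of_integralCurve {f : ℝ → ℝ} {z : ℝ → ℂ}
    (h : ∀ t, HasDerivAt z (field f (z t)) t) (hL : ∀ t, LipNear (field f) (z t))
    (hz : IsTrajectory f z) (t : ℝ) : flow f t (z 0) = z t := by
  have hex : ∃ y : ℝ → ℂ, IsTrajectory f y ∧ y 0 = z 0 := ⟨z, hz, rfl⟩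
  rw [flow, dif_pos hex]
  exact (congrFun (IsTrajectory.eq_of_integralCurve h hL hex.choose_spec.1
    hex.choose_spec.2.symm) t).symm

/-! ### Arcs parametrized by arc length -/

/-- `c` is a path on `s` with unit tangent `v` and signed curvature `κ`. -/
structure IsArc (s : Set ℝ) (κ : ℝ → ℝ) (c v : ℝ → ℂ) : Prop where
  hasDerivAt : ∀ t ∈ s, HasDerivAt c (v t) t
  hasDerivAt_tangent : ∀ t ∈ s, HasDerivAt v (I * κ t * v t) t
  norm_tangent : ∀ t ∈ s, ‖v t‖ = 1

/-- The path `z = -i · conj(c) · v` attached to a path `c` with tangent `v`. Its real part is the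
angular momentum `r² φ̇` of `c`, and its imaginary part is `- r ṙ`. -/
def momentum (c v : ℝ → ℂ) (t : ℝ) : ℂ := -I * starRingEnd ℂ (c t) * v t

namespace IsArc

variable {s : Set ℝ} {κ : ℝ → ℝ} {c v : ℝ → ℂ}

theorem conj_mul_tangent (h : IsArc s κ c v) {t : ℝ} (ht : t ∈ s) :
    starRingEnd ℂ (v t) * v t = 1 := by
  rw [← Complex.normSq_eq_conj_mul_self, Complex.normSq_eq_norm_sq, h.norm_tangent t ht]
  simp

theorem hasDerivAt_momentum (h : IsArc s κ c v) {t : ℝ} (ht : t ∈ s) :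
    HasDerivAt (momentum c v) (I * κ t * momentum c v t + -I) t := by
  have h1 := ((hasDerivAt_conj (h.hasDerivAt t ht)).const_mul (-I)).mul (h.hasDerivAt_tangent t ht)
  refine h1.congr_deriv ?_
  rw [momentum]
  linear_combination (-I) * h.conj_mul_tangent ht

theorem norm_momentum (h : IsArc s κ c v) {t : ℝ} (ht : t ∈ s) : ‖momentum c v t‖ = ‖c t‖ := by
  simp [momentum, h.norm_tangent t ht]

theorem momentum_eq_zero_iff (h : IsArc s κ c v) {t : ℝ} (ht : t ∈ s) :
    momentum c v t = 0 ↔ c t = 0 := by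
  rw [← norm_eq_zero, h.norm_momentum ht, norm_eq_zero]

/-- The path is recovered from its tangent and its momentum. -/
theorem eq_conj_momentum_mul (h : IsArc s κ c v) {t : ℝ} (ht : t ∈ s) :
    c t = -I * starRingEnd ℂ (momentum c v t) * v t := by
  have := h.conj_mul_tangent ht
  simp only [momentum, map_mul, map_neg, conj_I, conj_conj]
  linear_combination (-c t) * this + c t * (starRingEnd ℂ (v t) * v t) * I_sq

theorem hasDerivAt_norm_sq (h : IsArc s κ c v) {t : ℝ} (ht : t ∈ s) :
    HasDerivAt (fun t => ‖c t‖ ^ 2) (-2 * (momentum c v t).im) t := by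
  refine (h.hasDerivAt t ht).norm_sq.congr_deriv ?_
  simp [momentum]
  ring

theorem hasDerivAt_momentum_re (h : IsArc s κ c v) {t : ℝ} (ht : t ∈ s) :
    HasDerivAt (fun t => (momentum c v t).re) (-κ t * (momentum c v t).im) t := by
  refine (hasDerivAt_re (h.hasDerivAt_momentum ht)).congr_deriv ?_
  simp

theorem hasDerivAt_momentum_im (h : IsArc s κ c v) {t : ℝ} (ht : t ∈ s) :
    HasDerivAt (fun t => (momentum c v t).im) (κ t * (momentum c v t).re - 1) t := by
  refine (hasDerivAt_im (h.hasDerivAt_momentum ht)).congr_deriv ?_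
  simp
  ring

theorem hasDerivAt_momentum_field (h : IsArc s κ c v) {f : ℝ → ℝ} {t : ℝ} (ht : t ∈ s)
    (hκ : c t ≠ 0 → κ t = f ‖c t‖) :
    HasDerivAt (momentum c v) (field f (momentum c v t)) t := by
  refine (h.hasDerivAt_momentum ht).congr_deriv ?_
  by_cases h0 : c t = 0
  · rw [(h.momentum_eq_zero_iff ht).mpr h0]; simp
  · rw [field, h.norm_momentum ht, hκ h0]; ring

/-- The passages of an arc through the origin are isolated in time. -/
theorem eventually_ne_zero (h : IsArc s κ c v) {t : ℝ} (ht : t ∈ s) :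
    ∀ᶠ x in 𝓝[≠] t, c x ≠ 0 := by
  refine (h.hasDerivAt t ht).eventually_ne ?_
  intro h0
  have := h.norm_tangent t ht
  rw [h0, norm_zero] at this
  exact zero_ne_one this

/-- A continuous function that agrees with the curvature away from the passages through the origin
agrees with it at these passages too, since they are isolated. -/
theorem curvature_eq_of_eventually (h : IsArc s κ c v) {κ' : ℝ → ℝ} {t : ℝ} (ht : t ∈ s)
    (hκ : ContinuousAt κ t) (hκ' : ContinuousAt κ' t)
    (heq : ∀ᶠ x in 𝓝 t, c x ≠ 0 → κ x = κ' x) : κ t = κ' t := by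
  refine tendsto_nhds_unique (f := κ) (l := 𝓝[≠] t) (hκ.tendsto.mono_left nhdsWithin_le_nhds) ?_
  refine (hκ'.tendsto.mono_left nhdsWithin_le_nhds).congr' ?_
  filter_upwards [h.eventually_ne_zero ht, heq.filter_mono nhdsWithin_le_nhds] with x hx hx'
  exact (hx' hx).symm

end IsArc

theorem lipNear_field_of_ne_zero {f : ℝ → ℝ} (hf : ContDiffOn ℝ ∞ f (Ioi 0)) {p : ℂ}
    (hp : p ≠ 0) : LipNear (field f) p := by
  have h1 : ContDiffAt ℝ 1 f ‖p‖ :=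
    (hf.contDiffAt (Ioi_mem_nhds (norm_pos_iff.mpr hp))).of_le (by simp)
  have h2 : ContDiffAt ℝ 1 (fun z : ℂ => (f ‖z‖ : ℂ)) p :=
    Complex.ofRealCLM.contDiff.contDiffAt.comp p (h1.comp p (contDiffAt_norm ℝ hp))
  have h3 : ContDiffAt ℝ 1 (field f) p :=
    ((contDiffAt_const.mul contDiffAt_id).mul h2).sub contDiffAt_const
  exact h3.exists_lipschitzOnWith

/-- If `f` is bounded and Lipschitz on some `(0, ε)`, the field is Lipschitz at the origin. -/
theorem lipNear_field_zero {f : ℝ → ℝ} {ε B K : ℝ} (hε : 0 < ε)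
    (hB : ∀ x ∈ Ioo 0 ε, |f x| ≤ B)
    (hK : ∀ x ∈ Ioo 0 ε, ∀ y ∈ Ioo 0 ε, |f x - f y| ≤ K * |x - y|) : LipNear (field f) 0 := by
  have hB0 : 0 ≤ B := (abs_nonneg _).trans (hB (ε / 2) ⟨by linarith, by linarith⟩)
  have hK0 : 0 ≤ K := by
    have := (abs_nonneg _).trans
      (hK (ε / 2) ⟨by linarith, by linarith⟩ (ε / 3) ⟨by linarith, by linarith⟩)
    have h6 : |ε / 2 - ε / 3| = ε / 6 := by rw [abs_of_pos] <;> linarith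
    rw [h6] at this
    exact nonneg_of_mul_nonneg_left this (by linarith)
  refine ⟨(B + ε * K).toNNReal, Metric.ball 0 ε, Metric.ball_mem_nhds _ hε, ?_⟩
  refine LipschitzOnWith.of_dist_le_mul fun z hz w hw => ?_
  rw [mem_ball_zero_iff] at hz hw
  rw [Real.coe_toNNReal _ (by positivity)]
  have hfield : dist (field f z) (field f w) = ‖z * (f ‖z‖ : ℂ) - w * (f ‖w‖ : ℂ)‖ := by
    have h1 : field f z - field f w = I * (z * (f ‖z‖ : ℂ) - w * (f ‖w‖ : ℂ)) := by
      simp only [field]; ring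
    rw [dist_eq_norm, h1, norm_mul, norm_I, one_mul]
  have hone : ∀ p : ℂ, ‖p‖ < ε → ‖p * (f ‖p‖ : ℂ)‖ ≤ (B + ε * K) * ‖p‖ := by
    intro p hp
    by_cases h0 : p = 0
    · simp [h0]
    · rw [norm_mul, norm_real, Real.norm_eq_abs, mul_comm]
      have := hB ‖p‖ ⟨norm_pos_iff.mpr h0, hp⟩
      have h2 : |f ‖p‖| ≤ B + ε * K := this.trans (by nlinarith)
      exact mul_le_mul_of_nonneg_right h2 (norm_nonneg _)
  rw [hfield, dist_eq_norm]
  by_cases hz0 : z = 0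
  · simpa [hz0] using hone w hw
  by_cases hw0 : w = 0
  · simpa [hw0] using hone z hz
  have e : z * (f ‖z‖ : ℂ) - w * (f ‖w‖ : ℂ)
      = (z - w) * (f ‖z‖ : ℂ) + w * ((f ‖z‖ - f ‖w‖ : ℝ) : ℂ) := by push_cast; ring
  have hzI : ‖z‖ ∈ Ioo 0 ε := ⟨norm_pos_iff.mpr hz0, hz⟩
  have hwI : ‖w‖ ∈ Ioo 0 ε := ⟨norm_pos_iff.mpr hw0, hw⟩
  rw [e]
  calc _ ≤ ‖z - w‖ * |f ‖z‖| + ‖w‖ * |f ‖z‖ - f ‖w‖| := by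
        refine (norm_add_le _ _).trans ?_
        rw [norm_mul, norm_mul, norm_real, norm_real, Real.norm_eq_abs, Real.norm_eq_abs]
    _ ≤ ‖z - w‖ * B + ε * (K * ‖z - w‖) := by
        gcongr
        · exact hB _ hzI
        · refine (hK _ hzI _ hwI).trans ?_
          gcongr
          exact abs_norm_sub_norm_le z w
    _ = _ := by ring

/-- If a solution of `κ = f(r)` passes through the origin with Lipschitz curvature, then `f` is
bounded and Lipschitz near `0`, because `f = κ ∘ r⁻¹` and `r` has slope near `1`. -/
theorem lipNear_field_zero_of_passage {f : ℝ → ℝ} {s : Set ℝ} {κ : ℝ → ℝ} {c v : ℝ → ℂ}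
    (h : IsArc s κ c v) (hs : IsOpen s) (hκ : ∀ t ∈ s, c t ≠ 0 → κ t = f ‖c t‖) {a : ℝ}
    (ha : a ∈ s) (hca : c a = 0) (hLip : ∃ K, ∃ u ∈ 𝓝 a, LipschitzOnWith K κ u) :
    LipNear (field f) 0 := by
  obtain ⟨K, u, hu, hK⟩ := hLip
  set z := momentum c v with hz
  have hza : z a = 0 := (h.momentum_eq_zero_iff ha).mpr hca
  have hd : HasDerivAt z (-I) a := by
    have := h.hasDerivAt_momentum ha
    rw [← hz, hza] at this
    simpa using this
  have hlo := hd.isLittleO.def (show (0 : ℝ) < 1 / 4 by norm_num)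
  have hall : ∀ᶠ t in 𝓝 a, t ∈ s ∧ t ∈ u ∧ ‖z t + (t - a) * I‖ ≤ 1 / 4 * |t - a| := by
    filter_upwards [hs.mem_nhds ha, hu, hlo] with t h1 h2 h3
    refine ⟨h1, h2, ?_⟩
    rw [Real.norm_eq_abs] at h3
    have e : z t - z a - (t - a) • -I = z t + (t - a) * I := by
      rw [hza, sub_zero, Complex.real_smul]
      push_cast
      ring
    rwa [e] at h3
  obtain ⟨δ, hδ, hball⟩ := Metric.eventually_nhds_iff_ball.mp hall
  rw [Real.ball_eq_Ioo] at hball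
  set r : ℝ → ℝ := fun t => ‖z t‖ with hr
  set b := a + δ / 2 with hb
  have hmem : ∀ t ∈ Icc a b, t ∈ Ioo (a - δ) (a + δ) := fun t ht =>
    ⟨by linarith [ht.1], by linarith [ht.2]⟩
  have hz0 : ∀ t ∈ Ioc a b, z t ≠ 0 := by
    intro t ht h0
    have := (hball t (hmem t ⟨ht.1.le, ht.2⟩)).2.2
    rw [h0, zero_add, norm_mul, norm_I, mul_one, ← ofReal_sub, norm_real, Real.norm_eq_abs] at this
    have hp : 0 < |t - a| := abs_pos.mpr (by linarith [ht.1])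
    linarith
  have hrc : ContinuousOn r (Icc a b) := fun t ht =>
    (h.hasDerivAt_momentum (hball t (hmem t ht)).1).continuousAt.norm.continuousWithinAt
  have hrd : ∀ t ∈ Ioc a b, HasDerivAt r (-(z t).im / ‖z t‖) t := by
    intro t ht
    have hts := (hball t (hmem t ⟨ht.1.le, ht.2⟩)).1
    have h1 := (h.hasDerivAt_momentum hts).norm_sq.sqrt
      (by positivity [norm_pos_iff.mpr (hz0 t ht)])
    have h2 : r = fun t => √(‖momentum c v t‖ ^ 2) := by
      funext x; rw [Real.sqrt_sq (norm_nonneg _)]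
    rw [h2]
    refine h1.congr_deriv ?_
    rw [Real.sqrt_sq (norm_nonneg _), ← hz]
    have : ‖z t‖ ≠ 0 := (norm_pos_iff.mpr (hz0 t ht)).ne'
    field_simp
    simp
    ring
  have hgd : ∀ t ∈ Ioc a b,
      HasDerivAt (fun t => r t - 1 / 2 * t) (-(z t).im / ‖z t‖ - 1 / 2 * 1) t := fun t ht =>
    (hrd t ht).sub ((hasDerivAt_id t).const_mul (1 / 2))
  have hmono : MonotoneOn (fun t => r t - 1 / 2 * t) (Icc a b) := by
    refine monotoneOn_of_deriv_nonneg (convex_Icc a b)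
      (hrc.sub (continuous_const.mul continuous_id).continuousOn) ?_ ?_
    · intro t ht
      rw [interior_Icc] at ht
      exact (hgd t ⟨ht.1, ht.2.le⟩).differentiableAt.differentiableWithinAt
    · intro t ht
      rw [interior_Icc] at ht
      have ht' : t ∈ Ioc a b := ⟨ht.1, ht.2.le⟩
      rw [(hgd t ht').deriv]
      have hb := (hball t (hmem t ⟨ht.1.le, ht.2.le⟩)).2.2
      have hta : |t - a| = t - a := abs_of_pos (by linarith [ht.1])
      rw [hta] at hb
      have him : (z t).im ≤ -(3 / 4) * (t - a) := by
        have := (le_abs_self _).trans ((Complex.abs_im_le_norm _).trans hb)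
        simp at this
        linarith
      have hrr : ‖z t‖ ≤ 5 / 4 * (t - a) := by
        have e : z t = (z t + (t - a) * I) + -((t - a : ℝ) * I) := by push_cast; ring
        have := norm_add_le (z t + (t - a) * I) (-((t - a : ℝ) * I))
        rw [← e, norm_neg, norm_mul, norm_I, norm_real, Real.norm_eq_abs, hta] at this
        linarith
      have hpos : 0 < ‖z t‖ := norm_pos_iff.mpr (hz0 t ht')
      rw [mul_one, sub_nonneg, le_div_iff₀ hpos]
      linarith [ht.1]
  have hexp : ∀ x ∈ Icc a b, ∀ y ∈ Icc a b, |x - y| ≤ 2 * |r x - r y| := by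
    have key : ∀ x ∈ Icc a b, ∀ y ∈ Icc a b, x ≤ y → |x - y| ≤ 2 * |r x - r y| := by
      intro x hx y hy hxy
      have := hmono hx hy hxy
      simp only at this
      rw [abs_sub_comm, abs_of_nonneg (by linarith : 0 ≤ y - x)]
      have h1 := neg_abs_le (r x - r y)
      linarith
    intro x hx y hy
    rcases le_total x y with hxy | hxy
    · exact key x hx y hy hxy
    · rw [abs_sub_comm, abs_sub_comm (r x)]; exact key y hy x hx hxy
  have hab : a ≤ b := by linarith
  have hb_mem : b ∈ Ioc a b := ⟨by linarith, le_rfl⟩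
  have hsurj : ∀ ρ ∈ Ioo 0 (r b), ∃ t ∈ Ioc a b, r t = ρ := by
    intro ρ hρ
    have hra : r a = 0 := by simp [hr, hza]
    obtain ⟨t, ht, hteq⟩ := intermediate_value_Icc hab hrc (show ρ ∈ Icc (r a) (r b) from
      ⟨by rw [hra]; exact hρ.1.le, hρ.2.le⟩)
    refine ⟨t, ⟨lt_of_le_of_ne ht.1 ?_, ht.2⟩, hteq⟩
    rintro rfl
    rw [hra] at hteq
    exact hρ.1.ne hteq
  have hfr : ∀ t ∈ Ioc a b, f (r t) = κ t := by
    intro t ht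
    have hts := (hball t (hmem t ⟨ht.1.le, ht.2⟩)).1
    rw [hκ t hts (fun h0 => hz0 t ht ((h.momentum_eq_zero_iff hts).mpr h0)), hr]
    simp only [hz]
    rw [h.norm_momentum hts]
  have hKd : ∀ x ∈ Icc a b, ∀ y ∈ Icc a b, |κ x - κ y| ≤ K * |x - y| := fun x hx y hy => by
    simpa [Real.dist_eq] using
      hK.dist_le_mul x (hball x (hmem x hx)).2.1 y (hball y (hmem y hy)).2.1
  refine lipNear_field_zero (ε := r b) (B := |κ a| + K * δ) (K := K * 2)
    (norm_pos_iff.mpr (hz0 b hb_mem)) ?_ ?_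
  · intro ρ hρ
    obtain ⟨t, ht, rfl⟩ := hsurj ρ hρ
    have ht' : t ∈ Icc a b := ⟨ht.1.le, ht.2⟩
    rw [hfr t ht]
    have h1 := hKd t ht' a ⟨le_rfl, hab⟩
    have h2 : |t - a| ≤ δ := by rw [abs_of_pos (by linarith [ht.1])]; linarith [ht.2]
    have h3 := abs_sub_abs_le_abs_sub (κ t) (κ a)
    have h4 : (K : ℝ) * |t - a| ≤ K * δ := mul_le_mul_of_nonneg_left h2 K.2
    linarith
  · intro x hx y hy
    obtain ⟨t, ht, rfl⟩ := hsurj x hx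
    obtain ⟨t', ht', rfl⟩ := hsurj y hy
    have h1 : t ∈ Icc a b := ⟨ht.1.le, ht.2⟩
    have h2 : t' ∈ Icc a b := ⟨ht'.1.le, ht'.2⟩
    rw [hfr t ht, hfr t' ht', mul_assoc]
    exact (hKd t h1 t' h2).trans (mul_le_mul_of_nonneg_left (hexp t h1 t' h2) K.2)

/-! ### Smooth paths as arcs -/

namespace UnitSpeedPath

variable (c : UnitSpeedPath)

theorem contDiffOn_deriv : ContDiffOn ℝ ∞ (deriv c.toFun) c.J :=
  c.smooth.deriv_of_isOpen c.isOpen_J (by simp)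

theorem contDiffOn_curvature : ContDiffOn ℝ ∞ c.curvature c.J := by
  have h1 := c.contDiffOn_deriv
  have h2 : ContDiffOn ℝ ∞ (deriv (deriv c.toFun)) c.J := h1.deriv_of_isOpen c.isOpen_J (by simp)
  exact Complex.imCLM.contDiff.comp_contDiffOn
    ((Complex.conjCLE.contDiff.comp_contDiffOn h1).mul h2)

theorem continuousAt_curvature {t : ℝ} (ht : t ∈ c.J) : ContinuousAt c.curvature t :=
  c.contDiffOn_curvature.continuousOn.continuousAt (c.isOpen_J.mem_nhds ht)

theorem isPreconnected_J : IsPreconnected c.J := c.ordConnected_J.isPreconnected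

theorem isArc : IsArc c.J c.curvature c.toFun (deriv c.toFun) where
  hasDerivAt t ht := ((c.smooth.contDiffAt (c.isOpen_J.mem_nhds ht)).differentiableAt
    (by simp)).hasDerivAt
  norm_tangent := c.unit_speed
  hasDerivAt_tangent t ht := by
    have hd : HasDerivAt (deriv c.toFun) (deriv (deriv c.toFun) t) t :=
      ((c.contDiffOn_deriv.contDiffAt (c.isOpen_J.mem_nhds ht)).differentiableAt
        (by simp)).hasDerivAt
    refine hd.congr_deriv ?_
    set w := deriv c.toFun t with hw
    set w' := deriv (deriv c.toFun) t with hw'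
    have h1 : starRingEnd ℂ w * w = 1 := by
      rw [← Complex.normSq_eq_conj_mul_self, Complex.normSq_eq_norm_sq, c.unit_speed t ht]
      simp
    have h2 : (starRingEnd ℂ w * w').re = 0 := by
      have hn : HasDerivAt (fun t => ‖deriv c.toFun t‖ ^ 2) 0 t := by
        refine (hasDerivAt_const t (1 : ℝ)).congr_of_eventuallyEq ?_
        filter_upwards [c.isOpen_J.mem_nhds ht] with x hx
        rw [c.unit_speed x hx]; norm_num
      have := hd.norm_sq.unique hn
      simp only [← hw] at this
      rw [Complex.inner, mul_comm w'] at this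
      linarith
    have h3 : starRingEnd ℂ w * w' = I * c.curvature t := by
      apply Complex.ext
      · rw [h2]; simp
      · simp [curvature, hw, hw']
    linear_combination (-w') * h1 + w * h3

theorem assoc_eq_momentum : c.assoc = momentum c.toFun (deriv c.toFun) := rfl

variable {c} {f : ℝ → ℝ}

theorem IsSolution.lipNear (hc : c.IsSolution f) (hf : ContDiffOn ℝ ∞ f (Ioi 0)) {t : ℝ}
    (ht : t ∈ c.J) : LipNear (field f) (c.assoc t) := by
  by_cases h0 : c.toFun t = 0
  · rw [assoc_eq_momentum, (c.isArc.momentum_eq_zero_iff ht).mpr h0]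
    refine lipNear_field_zero_of_passage c.isArc c.isOpen_J hc ht h0 ?_
    exact ((c.contDiffOn_curvature.contDiffAt (c.isOpen_J.mem_nhds ht)).of_le
      (by simp)).exists_lipschitzOnWith
  · exact lipNear_field_of_ne_zero hf fun h => h0 ((c.isArc.momentum_eq_zero_iff ht).mp h)

theorem IsSolution.hasDerivAt_assoc (hc : c.IsSolution f) {t : ℝ} (ht : t ∈ c.J) :
    HasDerivAt c.assoc (field f (c.assoc t)) t :=
  c.isArc.hasDerivAt_momentum_field ht (hc t ht)

end UnitSpeedPath

/-! ### Curves whose trace is a topological circle -/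

/-- If `φ` is continuous at `a`, injective near `a` and takes values in the circle, then its values
near `a` fill a neighbourhood of `φ a`: the circle is one-dimensional. -/
theorem eventually_mem_image_of_injOn {φ : ℝ → Circle} {a δ₀ : ℝ} (hδ₀ : 0 < δ₀)
    (hφ : Continuous φ) (hinj : InjOn φ (Icc (a - δ₀) (a + δ₀))) :
    ∀ᶠ w in 𝓝 (φ a), ∃ s ∈ Icc (a - δ₀) (a + δ₀), φ s = w := by
  have hslit : ∀ᶠ w in 𝓝 (φ a), ((w / φ a : Circle) : ℂ) ∈ slitPlane := by
    have hc : ContinuousAt (fun w : Circle => ((w / φ a : Circle) : ℂ)) (φ a) := by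
      fun_prop
    refine hc.eventually (isOpen_slitPlane.mem_nhds ?_)
    simp
  obtain ⟨ε, hε, hball⟩ := Metric.eventually_nhds_iff_ball.mp (hφ.continuousAt.eventually hslit)
  rw [Real.ball_eq_Ioo] at hball
  set δ := min δ₀ (ε / 2) with hδ
  have hδ0 : 0 < δ := lt_min hδ₀ (by linarith)
  have hsub : Icc (a - δ) (a + δ) ⊆ Icc (a - δ₀) (a + δ₀) :=
    Icc_subset_Icc (by linarith [min_le_left δ₀ (ε / 2)]) (by linarith [min_le_left δ₀ (ε / 2)])
  have hsub' : Icc (a - δ) (a + δ) ⊆ Ioo (a - ε) (a + ε) := fun t ht =>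
    ⟨by linarith [ht.1, min_le_right δ₀ (ε / 2)], by linarith [ht.2, min_le_right δ₀ (ε / 2)]⟩
  set A : Circle → ℝ := fun w => Complex.arg ((w / φ a : Circle) : ℂ) with hA
  have hAinj : Function.Injective A := fun w w' h => by
    have := Circle.injective_arg h
    exact div_left_injective this
  have hAcont : ∀ w : Circle, ((w / φ a : Circle) : ℂ) ∈ slitPlane → ContinuousAt A w := by
    intro w hw
    have hc : ContinuousAt (fun w : Circle => ((w / φ a : Circle) : ℂ)) w := by fun_prop
    exact ContinuousAt.comp (g := Complex.arg) (Complex.continuousAt_arg hw) hc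
  set g : ℝ → ℝ := fun s => A (φ s) with hg
  have hgc : ContinuousOn g (Icc (a - δ) (a + δ)) := fun t ht =>
    ((hAcont (φ t) (hball t (hsub' ht))).comp hφ.continuousAt).continuousWithinAt
  have hginj : InjOn g (Icc (a - δ) (a + δ)) := fun x hx y hy h =>
    hinj (hsub hx) (hsub hy) (hAinj h)
  have hga : g a = 0 := by simp [hg, hA]
  have hl : a - δ ∈ Icc (a - δ) (a + δ) := ⟨le_rfl, by linarith⟩
  have hr : a + δ ∈ Icc (a - δ) (a + δ) := ⟨by linarith, le_rfl⟩
  have hm : a ∈ Icc (a - δ) (a + δ) := ⟨by linarith, by linarith⟩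
  have himg : ∀ᶠ y in 𝓝 (0 : ℝ), ∃ s ∈ Icc (a - δ) (a + δ), g s = y := by
    rcases hgc.strictMonoOn_of_injOn_Icc' (by linarith) hginj with h | h
    · have h1 := h hl hm (by linarith)
      have h2 := h hm hr (by linarith)
      rw [hga] at h1 h2
      filter_upwards [Icc_mem_nhds h1 h2] with y hy
      exact intermediate_value_Icc (by linarith) hgc hy
    · have h1 := h hl hm (by linarith)
      have h2 := h hm hr (by linarith)
      rw [hga] at h1 h2
      filter_upwards [Icc_mem_nhds h2 h1] with y hy
      exact intermediate_value_Icc' (by linarith) hgc hy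
  have hA0 : A (φ a) = 0 := hga
  have hev : ∀ᶠ w in 𝓝 (φ a), ∃ s ∈ Icc (a - δ) (a + δ), g s = A w := by
    have h0 := (hAcont (φ a) (by simp)).tendsto
    rw [hA0] at h0
    exact h0.eventually himg
  filter_upwards [hev] with w ⟨s, hs, hsw⟩
  exact ⟨s, hsub hs, hAinj hsw⟩

/-- If the trace of a regular curve is a topological circle, then branches of the curve that meet
are tangent to each other. -/
theorem IsArc.tangent_eq_or_eq_neg {κ : ℝ → ℝ} {c v : ℝ → ℂ} (h : IsArc univ κ c v)
    (hcirc : Nonempty (range c ≃ₜ Circle)) {a b : ℝ} (hab : c a = c b) :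
    v b = v a ∨ v b = -v a := by
  obtain ⟨Ψ⟩ := hcirc
  have hcc : Continuous c := continuous_iff_continuousAt.mpr fun t =>
    (h.hasDerivAt t (mem_univ t)).continuousAt
  have hvc : Continuous v := continuous_iff_continuousAt.mpr fun t =>
    (h.hasDerivAt_tangent t (mem_univ t)).continuousAt
  set φ : ℝ → Circle := fun t => Ψ ⟨c t, mem_range_self t⟩ with hφ
  have hφc : Continuous φ := Ψ.continuous.comp (hcc.subtype_mk _)
  have hφinj : ∀ {s t}, φ s = φ t → c s = c t := fun {s t} hst => by
    have := Ψ.injective hst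
    exact congrArg Subtype.val this
  have hva := h.conj_mul_tangent (mem_univ a)
  -- `q` is the inner product of the two tangents, a number of modulus one.
  set q : ℂ := starRingEnd ℂ (v a) * v b with hq
  have hvb : v b = v a * q := by rw [hq]; linear_combination (-v b) * hva
  have hqn : ‖q‖ = 1 := by
    rw [hq, norm_mul, RCLike.norm_conj, h.norm_tangent a (mem_univ a),
      h.norm_tangent b (mem_univ b), one_mul]
  by_cases hq0 : q.im = 0
  · have hqr : q = (q.re : ℂ) := Complex.ext (by simp) (by simp [hq0])
    rw [hqr, norm_real, Real.norm_eq_abs] at hqn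
    rcases (abs_eq zero_le_one).mp hqn with h1 | h1
    · left; rw [hvb, hqr, h1]; simp
    · right; rw [hvb, hqr, h1]; simp
  exfalso
  set η := |q.im| with hη
  have hη0 : 0 < η := abs_pos.mpr hq0
  set d : ℝ → ℂ := fun t => starRingEnd ℂ (v a) * (c t - c a) with hd
  have hda : HasDerivAt d 1 a := by
    have := ((h.hasDerivAt a (mem_univ a)).sub_const (c a)).const_mul (starRingEnd ℂ (v a))
    rwa [hva] at this
  have hdb : HasDerivAt d q b :=
    ((h.hasDerivAt b (mem_univ b)).sub_const (c a)).const_mul (starRingEnd ℂ (v a))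
  have hd0 : d a = 0 := by simp [hd]
  have hd0b : d b = 0 := by simp [hd, hab]
  -- Near `a` the curve stays in a thin cone about its tangent line at `a`, near `b` outside it.
  have ha1 : ∀ᶠ t in 𝓝 a, |(d t).im| ≤ η / 4 * ‖d t‖ := by
    have h1 := hda.isLittleO.def (show 0 < min (η / 8) (1 / 2) by positivity)
    filter_upwards [h1] with t ht
    rw [hd0, sub_zero, Complex.real_smul, mul_one, Real.norm_eq_abs] at ht
    have h2 : |(d t).im| ≤ min (η / 8) (1 / 2) * |t - a| := by
      have := (Complex.abs_im_le_norm (d t - (t - a : ℝ))).trans ht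
      simpa using this
    have h3 : |t - a| ≤ ‖d t‖ + min (η / 8) (1 / 2) * |t - a| := by
      have := norm_sub_norm_le (((t - a : ℝ) : ℂ)) (d t)
      rw [norm_sub_rev, norm_real, Real.norm_eq_abs] at this
      linarith
    have h4 : min (η / 8) (1 / 2) * |t - a| ≤ 1 / 2 * |t - a| :=
      mul_le_mul_of_nonneg_right (min_le_right _ _) (abs_nonneg _)
    have h5 : min (η / 8) (1 / 2) * |t - a| ≤ η / 8 * |t - a| :=
      mul_le_mul_of_nonneg_right (min_le_left _ _) (abs_nonneg _)
    nlinarith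
  have hb1 : ∀ᶠ t in 𝓝[≠] b, η / 4 * ‖d t‖ < |(d t).im| := by
    have h1 := hdb.isLittleO.def (show 0 < min (η / 4) (1 / 2) by positivity)
    filter_upwards [h1.filter_mono nhdsWithin_le_nhds, self_mem_nhdsWithin] with t ht htb
    rw [hd0b, sub_zero, Complex.real_smul, Real.norm_eq_abs] at ht
    have hpos : 0 < |t - b| := abs_pos.mpr (sub_ne_zero.mpr htb)
    have h2 : |(d t).im - (t - b) * q.im| ≤ min (η / 4) (1 / 2) * |t - b| := by
      have := (Complex.abs_im_le_norm (d t - (t - b : ℝ) * q)).trans ht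
      simpa using this
    have h3 : ‖d t‖ ≤ |t - b| + min (η / 4) (1 / 2) * |t - b| := by
      have := norm_sub_norm_le (d t) (((t - b : ℝ) : ℂ) * q)
      rw [norm_mul ((t - b : ℝ) : ℂ) q, hqn, norm_real, Real.norm_eq_abs, mul_one] at this
      linarith
    have h4 : min (η / 4) (1 / 2) * |t - b| ≤ 1 / 2 * |t - b| :=
      mul_le_mul_of_nonneg_right (min_le_right _ _) (abs_nonneg _)
    have h5 : min (η / 4) (1 / 2) * |t - b| ≤ η / 4 * |t - b| :=
      mul_le_mul_of_nonneg_right (min_le_left _ _) (abs_nonneg _)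
    have h6 : |t - b| * η ≤ |(d t).im| + min (η / 4) (1 / 2) * |t - b| := by
      have := abs_sub_abs_le_abs_sub ((t - b) * q.im) (d t).im
      rw [abs_mul, abs_sub_comm ((t - b) * q.im)] at this
      linarith
    nlinarith
  have hinj : ∃ δ > 0, InjOn φ (Icc (a - δ) (a + δ)) ∧
      ∀ t ∈ Icc (a - δ) (a + δ), |(d t).im| ≤ η / 4 * ‖d t‖ := by
    have hpos : ∀ᶠ t in 𝓝 a, 0 < (starRingEnd ℂ (v a) * v t).re := by
      have hc : Continuous fun t => (starRingEnd ℂ (v a) * v t).re :=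
        Complex.continuous_re.comp (continuous_const.mul hvc)
      refine hc.continuousAt.eventually (lt_mem_nhds ?_)
      simp [hva]
    obtain ⟨ε, hε, hball⟩ := Metric.eventually_nhds_iff_ball.mp (hpos.and ha1)
    rw [Real.ball_eq_Ioo] at hball
    have hsub : Icc (a - ε / 2) (a + ε / 2) ⊆ Ioo (a - ε) (a + ε) := fun t ht =>
      ⟨by linarith [ht.1], by linarith [ht.2]⟩
    refine ⟨ε / 2, by linarith, ?_, fun t ht => (hball t (hsub ht)).2⟩
    have hder : ∀ t, HasDerivAt (fun t => (d t).re) (starRingEnd ℂ (v a) * v t).re t := fun t =>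
      hasDerivAt_re (((h.hasDerivAt t (mem_univ t)).sub_const (c a)).const_mul _)
    have hmono : StrictMonoOn (fun t => (d t).re) (Icc (a - ε / 2) (a + ε / 2)) := by
      refine strictMonoOn_of_deriv_pos (convex_Icc _ _)
        (fun t _ => (hder t).continuousAt.continuousWithinAt) fun t ht => ?_
      rw [(hder t).deriv]
      exact (hball t (hsub (interior_subset ht))).1
    intro x hx y hy hxy
    refine hmono.injOn hx hy ?_
    simp only [hd, hφinj hxy]
  obtain ⟨δ, hδ, hinj, hcone⟩ := hinj
  have hφab : φ a = φ b := by simp only [hφ, hab]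
  have hev : ∀ᶠ t in 𝓝 b, ∃ s ∈ Icc (a - δ) (a + δ), φ s = φ t := by
    have h0 := hφc.continuousAt.tendsto (x := b)
    rw [← hφab] at h0
    exact h0.eventually (eventually_mem_image_of_injOn hδ hφc hinj)
  obtain ⟨t, ⟨s, hs, hst⟩, ht⟩ := ((hev.filter_mono nhdsWithin_le_nhds).and hb1).exists
  have hdd : d s = d t := by simp only [hd, hφinj hst]
  have := hcone s hs
  rw [hdd] at this
  linarith

/-- A locally convex curve with total turning `2π` per period is a simple closed curve: a chord
that joins two points of the curve at which the tangent angles differ by at most `π` cannot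
vanish. -/
theorem range_homeomorph_circle_of_turning {ϑ : ℝ → ℝ} {c : ℝ → ℂ} {u : ℂ} {L : ℝ} (hL : 0 < L)
    (hu : ‖u‖ = 1) (hϑ : StrictMono ϑ) (hϑL : ∀ t, ϑ (t + L) = ϑ t + 2 * Real.pi)
    (hc : ∀ t, HasDerivAt c (u * exp (ϑ t * I)) t) (hcL : ∀ t, c (t + L) = c t) :
    Nonempty (range c ≃ₜ Circle) := by
  have hcc : Continuous c := continuous_iff_continuousAt.mpr fun t => (hc t).continuousAt
  have hu' : starRingEnd ℂ u * u = 1 := by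
    rw [← Complex.normSq_eq_conj_mul_self, Complex.normSq_eq_norm_sq, hu]
    simp
  -- The curve advances in the direction of the mean tangent angle.
  have key : ∀ s t, s < t → ϑ t - ϑ s ≤ Real.pi → c s ≠ c t := by
    intro s t hst hle heq
    set m := (ϑ s + ϑ t) / 2 with hm
    set g : ℝ → ℝ := fun x => (starRingEnd ℂ u * exp (-(m * I)) * c x).re with hg
    have hgd : ∀ x, HasDerivAt g (Real.cos (ϑ x - m)) x := by
      intro x
      have h1 := hasDerivAt_re ((hc x).const_mul (starRingEnd ℂ u * exp (-(m * I))))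
      refine h1.congr_deriv ?_
      have : starRingEnd ℂ u * exp (-(m * I)) * (u * exp (ϑ x * I))
          = exp (((ϑ x - m : ℝ) : ℂ) * I) := by
        have e : exp (((ϑ x - m : ℝ) : ℂ) * I) = exp (-(m * I)) * exp (ϑ x * I) := by
          rw [← Complex.exp_add]; congr 1; push_cast; ring
        rw [e]; linear_combination (exp (-(m * I)) * exp (ϑ x * I)) * hu'
      rw [this, Complex.exp_ofReal_mul_I_re]
    have hmono : StrictMonoOn g (Icc s t) := by
      refine strictMonoOn_of_deriv_pos (convex_Icc _ _)
        (fun x _ => (hgd x).continuousAt.continuousWithinAt) fun x hx => ?_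
      rw [interior_Icc] at hx
      rw [(hgd x).deriv]
      have h1 := hϑ hx.1
      have h2 := hϑ hx.2
      refine Real.cos_pos_of_mem_Ioo ⟨?_, ?_⟩ <;> linarith
    have := hmono ⟨le_rfl, hst.le⟩ ⟨hst.le, le_rfl⟩ hst
    simp only [hg, heq, lt_irrefl] at this
  have : Fact (0 < L) := ⟨hL⟩
  have hper : Function.Periodic c L := hcL
  have hlift : Continuous (hper.lift : AddCircle L → ℂ) :=
    continuous_coinduced_dom.mpr hcc
  let F : AddCircle L → range c := fun x => ⟨hper.lift x, by
    induction x using QuotientAddGroup.induction_on with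
    | H t => exact ⟨t, (hper.lift_coe t).symm⟩⟩
  have hFc : Continuous F := hlift.subtype_mk _
  have hlt : ∀ s t, s < t → t < s + L → c s ≠ c t := by
    intro s t hst htL
    by_cases hle : ϑ t - ϑ s ≤ Real.pi
    · exact key s t hst hle
    · have := key t (s + L) htL (by rw [hϑL]; linarith)
      rw [hcL] at this
      exact this.symm
  have hFb : Function.Bijective F := by
    constructor
    · intro x y hxy
      obtain ⟨s, hs, rfl⟩ := AddCircle.coe_image_Ico_eq L 0 ▸ mem_univ x
      obtain ⟨t, ht, rfl⟩ := AddCircle.coe_image_Ico_eq L 0 ▸ mem_univ y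
      have h1 : c s = c t := congrArg Subtype.val hxy
      rcases lt_trichotomy s t with h | h | h
      · exact absurd h1 (hlt s t h (by linarith [hs.1, ht.2]))
      · rw [h]
      · exact absurd h1.symm (hlt t s h (by linarith [ht.1, hs.2]))
    · rintro ⟨_, t, rfl⟩
      exact ⟨(t : AddCircle L), Subtype.ext (hper.lift_coe t)⟩
  exact ⟨(hFc.homeoOfEquivCompactToT2 (f := Equiv.ofBijective F hFb)).symm.trans
    (AddCircle.homeomorphCircle hL.ne')⟩

/-! ### The tangent angle -/

/-- The tangent angle of a curve with curvature `κ`, measured from the time `a`. -/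
def tangentAngle (κ : ℝ → ℝ) (a t : ℝ) : ℝ := ∫ s in a..t, κ s

theorem hasDerivAt_tangentAngle {κ : ℝ → ℝ} (hκ : Continuous κ) (a t : ℝ) :
    HasDerivAt (tangentAngle κ a) (κ t) t :=
  intervalIntegral.integral_hasDerivAt_right (hκ.intervalIntegrable _ _)
    (hκ.stronglyMeasurableAtFilter _ _) hκ.continuousAt

@[simp] theorem tangentAngle_self (κ : ℝ → ℝ) (a : ℝ) :
    tangentAngle κ a a = 0 := by simp [tangentAngle]

theorem continuous_tangentAngle {κ : ℝ → ℝ} (hκ : Continuous κ) (a : ℝ) :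
    Continuous (tangentAngle κ a) :=
  continuous_iff_continuousAt.mpr fun t => (hasDerivAt_tangentAngle hκ a t).continuousAt

theorem hasDerivAt_exp_tangentAngle {κ : ℝ → ℝ} (hκ : Continuous κ)
    (a t : ℝ) (u : ℂ) : HasDerivAt (fun t => u * exp (tangentAngle κ a t * I))
      (I * κ t * (u * exp (tangentAngle κ a t * I))) t := by
  have h1 : HasDerivAt (fun t => exp (tangentAngle κ a t * I)) _ t :=
    (((hasDerivAt_tangentAngle hκ a t).ofReal_comp).mul_const I).cexp
  refine (h1.const_mul u).congr_deriv ?_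
  ring

/-! ### Oscillating arcs -/

/-- A complete arc whose curvature is symmetric about the times `a` and `a + τ`, whose distance
from the origin is critical at these two times, and which recedes from the origin in between. -/
structure IsOscillating (κ : ℝ → ℝ) (c v : ℝ → ℂ) (a τ : ℝ) : Prop extends IsArc univ κ c v where
  continuous : Continuous κ
  pos : 0 < τ
  symm_left : ∀ t, κ (2 * a - t) = κ t
  symm_right : ∀ t, κ (2 * (a + τ) - t) = κ t
  im_left : (momentum c v a).im = 0
  im_right : (momentum c v (a + τ)).im = 0
  im_neg : ∀ t ∈ Ioo a (a + τ), (momentum c v t).im < 0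

/-- Every time is carried into `[a, a + τ]` by a composition of the reflections about `a` and
`a + τ`. -/
theorem exists_reflection_reduced {τ : ℝ} (hτ : 0 < τ) (a t : ℝ) :
    ∃ s ∈ Icc a (a + τ), ∃ k : ℤ, t = s + k * (2 * τ) ∨ t = 2 * a - s + k * (2 * τ) := by
  obtain ⟨k, hk, -⟩ := existsUnique_sub_zsmul_mem_Ico (show 0 < 2 * τ by linarith) t a
  set u := t - k • (2 * τ) with hu
  have htu : t = u + k * (2 * τ) := by rw [hu, zsmul_eq_mul]; ring
  rcases le_total u (a + τ) with hle | hle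
  · exact ⟨u, ⟨hk.1, hle⟩, k, Or.inl htu⟩
  · refine ⟨2 * (a + τ) - u, ⟨by linarith [hk.2], by linarith⟩, k + 1, Or.inr ?_⟩
    push_cast; linarith

/-- The momentum of an arc with curvature symmetric about `b` is symmetric about `b`, provided it is
real at `b`. -/
theorem IsArc.momentum_reflect {κ : ℝ → ℝ} {c v : ℝ → ℂ} (h : IsArc univ κ c v) {b : ℝ}
    (hκ : ∀ t, κ (2 * b - t) = κ t) (hb : (momentum c v b).im = 0) (t : ℝ) :
    momentum c v (2 * b - t) = starRingEnd ℂ (momentum c v t) := by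
  have h2 : ∀ t ∈ univ, HasDerivAt (fun t => starRingEnd ℂ (momentum c v (2 * b - t)))
      (I * κ t * starRingEnd ℂ (momentum c v (2 * b - t)) + -I) t := by
    intro t _
    have h1 := (h.hasDerivAt_momentum (mem_univ (2 * b - t))).scomp t
      ((hasDerivAt_id t).const_sub (2 * b))
    refine (hasDerivAt_conj h1).congr_deriv ?_
    simp [hκ]
  have := eqOn_of_linear isPreconnected_univ isOpen_univ
    (fun t ht => h.hasDerivAt_momentum ht) h2 (mem_univ b)
    (by rw [show 2 * b - b = b by ring]; exact (Complex.conj_eq_iff_im.mpr hb).symm)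
  rw [this (mem_univ t), conj_conj]

namespace IsOscillating

variable {κ : ℝ → ℝ} {c v : ℝ → ℂ} {a τ : ℝ}

theorem momentum_left (h : IsOscillating κ c v a τ) (t : ℝ) :
    momentum c v (2 * a - t) = starRingEnd ℂ (momentum c v t) :=
  h.toIsArc.momentum_reflect h.symm_left h.im_left t

theorem momentum_right (h : IsOscillating κ c v a τ) (t : ℝ) :
    momentum c v (2 * (a + τ) - t) = starRingEnd ℂ (momentum c v t) :=
  h.toIsArc.momentum_reflect h.symm_right h.im_right t

theorem momentum_periodic (h : IsOscillating κ c v a τ) :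
    Function.Periodic (momentum c v) (2 * τ) := by
  intro t
  have := h.momentum_right (2 * a - t)
  rw [h.momentum_left, conj_conj] at this
  rw [← this]; congr 1; ring

theorem curvature_periodic (h : IsOscillating κ c v a τ) : Function.Periodic κ (2 * τ) := by
  intro t
  have := h.symm_right (2 * a - t)
  rw [h.symm_left] at this
  rw [← this]; congr 1; ring

theorem exists_reduced (h : IsOscillating κ c v a τ) (t : ℝ) :
    ∃ s ∈ Icc a (a + τ),
      momentum c v t = momentum c v s ∨ momentum c v t = starRingEnd ℂ (momentum c v s) := by
  obtain ⟨s, hs, k, rfl | rfl⟩ := exists_reflection_reduced h.pos a t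
  · exact ⟨s, hs, Or.inl ((h.momentum_periodic.int_mul k) s)⟩
  · refine ⟨s, hs, Or.inr ?_⟩
    rw [(h.momentum_periodic.int_mul k) (2 * a - s), h.momentum_left]

theorem continuous_path (h : IsOscillating κ c v a τ) : Continuous c :=
  continuous_iff_continuousAt.mpr fun t => (h.hasDerivAt t (mem_univ t)).continuousAt

theorem continuous_momentum (h : IsOscillating κ c v a τ) : Continuous (momentum c v) :=
  continuous_iff_continuousAt.mpr fun t => (h.hasDerivAt_momentum (mem_univ t)).continuousAt

theorem norm_strictMonoOn (h : IsOscillating κ c v a τ) :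
    StrictMonoOn (fun t => ‖c t‖) (Icc a (a + τ)) := by
  have hsq : StrictMonoOn (fun t => ‖c t‖ ^ 2) (Icc a (a + τ)) := by
    refine strictMonoOn_of_deriv_pos (convex_Icc _ _)
      (h.continuous_path.norm.pow 2).continuousOn fun t ht => ?_
    rw [interior_Icc] at ht
    rw [(h.hasDerivAt_norm_sq (mem_univ t)).deriv]
    linarith [h.im_neg t ht]
  intro s hs t ht hst
  exact lt_of_pow_lt_pow_left₀ 2 (norm_nonneg _) (hsq hs ht hst)

theorem norm_eq_abs_re_left (h : IsOscillating κ c v a τ) : ‖c a‖ = |(momentum c v a).re| := by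
  rw [← h.norm_momentum (mem_univ a), Complex.abs_re_eq_norm.mpr h.im_left]

theorem norm_eq_abs_re_right (h : IsOscillating κ c v a τ) :
    ‖c (a + τ)‖ = |(momentum c v (a + τ)).re| := by
  rw [← h.norm_momentum (mem_univ _), Complex.abs_re_eq_norm.mpr h.im_right]

theorem momentum_ne_zero (h : IsOscillating κ c v a τ) {t : ℝ} (ht : t ∈ Ioc a (a + τ)) :
    momentum c v t ≠ 0 := by
  intro h0
  have h1 := h.norm_strictMonoOn ⟨le_rfl, by linarith [h.pos]⟩ ⟨ht.1.le, ht.2⟩ ht.1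
  simp only [(h.momentum_eq_zero_iff (mem_univ t)).mp h0, norm_zero] at h1
  exact absurd h1 (not_lt.mpr (norm_nonneg _))

theorem reflect_conj (h : IsOscillating κ c v a τ) :
    IsOscillating (fun t => -κ t) (fun t => starRingEnd ℂ (c t)) (fun t => starRingEnd ℂ (v t))
      a τ := by
  have hm : ∀ t, momentum (fun t => starRingEnd ℂ (c t)) (fun t => starRingEnd ℂ (v t)) t
      = -starRingEnd ℂ (momentum c v t) := by
    intro t; simp [momentum]
  refine { hasDerivAt := fun t ht => hasDerivAt_conj (h.hasDerivAt t ht)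
           hasDerivAt_tangent := fun t ht => ?_
           norm_tangent := fun t ht => by rw [RCLike.norm_conj]; exact h.norm_tangent t ht
           continuous := h.continuous.neg
           pos := h.pos
           symm_left := fun t => by rw [h.symm_left]
           symm_right := fun t => by rw [h.symm_right]
           im_left := by rw [hm]; simp [h.im_left]
           im_right := by rw [hm]; simp [h.im_right]
           im_neg := fun t ht => by rw [hm]; simpa using h.im_neg t ht }
  refine (hasDerivAt_conj (h.hasDerivAt_tangent t ht)).congr_deriv ?_
  simp

theorem tangent_eq (h : IsOscillating κ c v a τ) (t : ℝ) :
    v t = v a * exp (tangentAngle κ a t * I) := by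
  have := eqOn_of_linear (β := 0) isPreconnected_univ isOpen_univ
    (fun t ht => by simpa using h.hasDerivAt_tangent t ht)
    (fun t _ => by simpa using hasDerivAt_exp_tangentAngle h.continuous a t (v a)) (mem_univ a)
    (by simp)
  exact this (mem_univ t)

theorem tangentAngle_left (h : IsOscillating κ c v a τ) (t : ℝ) :
    tangentAngle κ a (2 * a - t) = -tangentAngle κ a t := by
  have h1 : ∀ x, HasDerivAt (fun x => tangentAngle κ a (2 * a - x) + tangentAngle κ a x) 0 x := by
    intro x
    have := ((hasDerivAt_tangentAngle h.continuous a (2 * a - x)).comp x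
      ((hasDerivAt_id x).const_sub (2 * a))).add (hasDerivAt_tangentAngle h.continuous a x)
    refine this.congr_deriv ?_
    rw [h.symm_left]; ring
  have := is_const_of_deriv_eq_zero (fun x => (h1 x).differentiableAt) (fun x => (h1 x).deriv) t a
  rw [show 2 * a - a = a by ring] at this
  simp at this
  linarith

theorem tangentAngle_right (h : IsOscillating κ c v a τ) (t : ℝ) :
    tangentAngle κ a (2 * (a + τ) - t) = 2 * tangentAngle κ a (a + τ) - tangentAngle κ a t := by
  have h1 : ∀ x,
      HasDerivAt (fun x => tangentAngle κ a (2 * (a + τ) - x) + tangentAngle κ a x) 0 x := by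
    intro x
    have := ((hasDerivAt_tangentAngle h.continuous a (2 * (a + τ) - x)).comp x
      ((hasDerivAt_id x).const_sub (2 * (a + τ)))).add (hasDerivAt_tangentAngle h.continuous a x)
    refine this.congr_deriv ?_
    rw [h.symm_right]; ring
  have := is_const_of_deriv_eq_zero (fun x => (h1 x).differentiableAt) (fun x => (h1 x).deriv) t
    (a + τ)
  rw [show 2 * (a + τ) - (a + τ) = a + τ by ring] at this
  linarith

theorem tangentAngle_add_period (h : IsOscillating κ c v a τ) (t : ℝ) :
    tangentAngle κ a (t + 2 * τ) = tangentAngle κ a t + 2 * tangentAngle κ a (a + τ) := by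
  have := h.tangentAngle_right (2 * a - t)
  rw [h.tangentAngle_left, show 2 * (a + τ) - (2 * a - t) = t + 2 * τ by ring] at this
  linarith

theorem tangentAngle_add_nat_mul (h : IsOscillating κ c v a τ) (j : ℕ) (t : ℝ) :
    tangentAngle κ a (t + j * (2 * τ))
      = tangentAngle κ a t + 2 * (j * tangentAngle κ a (a + τ)) := by
  induction j with
  | zero => simp
  | succ k ih =>
    rw [show t + ((k + 1 : ℕ) : ℝ) * (2 * τ) = (t + k * (2 * τ)) + 2 * τ by push_cast; ring,
      h.tangentAngle_add_period, ih]
    push_cast; ring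

end IsOscillating

/-! ### Convex oscillating arcs -/

/-- An oscillating arc that is positively curved away from the origin and whose curvature is
strictly monotone between two consecutive critical times of the distance from the origin. -/
structure IsConvexOscillating (κ : ℝ → ℝ) (c v : ℝ → ℂ) (a τ : ℝ) : Prop
    extends IsOscillating κ c v a τ where
  curvature_pos : ∀ t, c t ≠ 0 → 0 < κ t
  curvature_mono : StrictMonoOn κ (Ioo a (a + τ)) ∨ StrictAntiOn κ (Ioo a (a + τ))

namespace IsConvexOscillating

variable {κ : ℝ → ℝ} {c v : ℝ → ℂ} {a τ : ℝ}

theorem curvature_pos_Ioc (h : IsConvexOscillating κ c v a τ) {t : ℝ} (ht : t ∈ Ioc a (a + τ)) :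
    0 < κ t :=
  h.curvature_pos t fun h0 => h.momentum_ne_zero ht ((h.momentum_eq_zero_iff (mem_univ t)).mpr h0)

theorem curvature_nonneg (h : IsConvexOscillating κ c v a τ) (t : ℝ) : 0 ≤ κ t := by
  refine ge_of_tendsto (x := 𝓝[≠] t)
    (h.continuous.continuousAt.tendsto.mono_left nhdsWithin_le_nhds) ?_
  filter_upwards [h.eventually_ne_zero (mem_univ t)] with x hx
  exact (h.curvature_pos x hx).le

theorem tangentAngle_strictMono (h : IsConvexOscillating κ c v a τ) :
    StrictMono (tangentAngle κ a) := by
  have hm : Monotone (tangentAngle κ a) := monotone_of_deriv_nonneg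
    (fun t => (hasDerivAt_tangentAngle h.continuous a t).differentiableAt) fun t => by
      rw [(hasDerivAt_tangentAngle h.continuous a t).deriv]; exact h.curvature_nonneg t
  -- On an interval where `ϑ` is constant, `κ` would vanish and the curve would rest at the origin.
  refine hm.strictMono_of_injective fun s t hst => ?_
  by_contra hne
  wlog hlt : s < t generalizing s t
  · exact this t s hst.symm (Ne.symm hne) (lt_of_le_of_ne (not_lt.mp hlt) (Ne.symm hne))
  have hconst : ∀ x ∈ Ioo s t, κ x = 0 := by
    intro x hx
    refine (hasDerivAt_tangentAngle h.continuous a x).unique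
      ((hasDerivAt_const x (tangentAngle κ a s)).congr_of_eventuallyEq ?_)
    filter_upwards [Ioo_mem_nhds hx.1 hx.2] with y hy
    exact le_antisymm ((hm hy.2.le).trans hst.ge) (hm hy.1.le)
  have hmid : (s + t) / 2 ∈ Ioo s t := ⟨by linarith, by linarith⟩
  have hev : ∀ᶠ x in 𝓝[≠] ((s + t) / 2), x ∈ Ioo s t :=
    nhdsWithin_le_nhds (Ioo_mem_nhds hmid.1 hmid.2)
  obtain ⟨x, hx, hx'⟩ := ((h.eventually_ne_zero (mem_univ ((s + t) / 2))).and hev).exists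
  exact (h.curvature_pos x hx).ne' (hconst x hx')

theorem tangentAngle_half_pos (h : IsConvexOscillating κ c v a τ) :
    0 < tangentAngle κ a (a + τ) := by
  have := h.tangentAngle_strictMono (show a < a + τ by linarith [h.pos])
  simpa using this

theorem momentum_re_strictMonoOn (h : IsConvexOscillating κ c v a τ) :
    StrictMonoOn (fun t => (momentum c v t).re) (Icc a (a + τ)) := by
  refine strictMonoOn_of_deriv_pos (convex_Icc _ _)
    (Complex.continuous_re.comp h.continuous_momentum).continuousOn fun t ht => ?_
  rw [interior_Icc] at ht
  rw [(h.hasDerivAt_momentum_re (mem_univ t)).deriv]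
  have h1 := h.im_neg t ht
  have h2 := h.curvature_pos_Ioc ⟨ht.1, ht.2.le⟩
  nlinarith

theorem momentum_re_right_pos (h : IsConvexOscillating κ c v a τ) :
    0 < (momentum c v (a + τ)).re := by
  have hl : a ∈ Icc a (a + τ) := ⟨le_rfl, by linarith [h.pos]⟩
  have hr : a + τ ∈ Icc a (a + τ) := ⟨by linarith [h.pos], le_rfl⟩
  have h1 := h.norm_strictMonoOn hl hr (by linarith [h.pos])
  have h2 := h.momentum_re_strictMonoOn hl hr (by linarith [h.pos])
  simp only [h.norm_eq_abs_re_left, h.norm_eq_abs_re_right] at h1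
  simp only at h2
  by_contra hn
  rw [not_lt] at hn
  rw [abs_of_nonpos hn, abs_of_nonpos (h2.le.trans hn)] at h1
  linarith

/-- If the half-period turning is `π / n`, the curve closes up after `n` periods with total turning
`2π`, and is therefore simple. -/
theorem range_homeomorph_circle (h : IsConvexOscillating κ c v a τ) {n : ℕ}
    (hn : n * tangentAngle κ a (a + τ) = Real.pi) : Nonempty (range c ≃ₜ Circle) := by
  have hn0 : 0 < n := by
    rcases Nat.eq_zero_or_pos n with rfl | h0
    · simp at hn; exact absurd hn.symm Real.pi_ne_zero
    · exact h0
  have hϑL : ∀ t, tangentAngle κ a (t + n * (2 * τ)) = tangentAngle κ a t + 2 * Real.pi := by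
    intro t; rw [h.tangentAngle_add_nat_mul, hn]
  have hp := h.pos
  refine range_homeomorph_circle_of_turning (L := n * (2 * τ)) (by positivity)
    (h.norm_tangent a (mem_univ a)) h.tangentAngle_strictMono hϑL (fun t => ?_) fun t => ?_
  · rw [← h.tangent_eq]; exact h.hasDerivAt t (mem_univ t)
  · rw [h.eq_conj_momentum_mul (mem_univ (t + n * (2 * τ))), h.eq_conj_momentum_mul (mem_univ t),
      h.tangent_eq (t + n * (2 * τ)), h.tangent_eq t, hϑL,
      (h.momentum_periodic.nat_mul n) t]
    congr 2
    push_cast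
    rw [add_mul, Complex.exp_add, Complex.exp_two_pi_mul_I, mul_one]

/-- The turning over a full period is not `2π`. This is the obstruction of the four-vertex theorem:
on half a period, both `cos ϑ` and `κ cos ϑ` would integrate to zero, although `cos ϑ` changes its
sign only once and `κ` is strictly monotone. -/
theorem tangentAngle_half_ne_pi (h : IsConvexOscillating κ c v a τ) :
    tangentAngle κ a (a + τ) ≠ Real.pi := by
  intro hβ
  have hp := h.pos
  obtain ⟨ε, hε⟩ : ∃ ε : ℝ, StrictMonoOn (fun t => ε * κ t) (Ioo a (a + τ)) := by
    rcases h.curvature_mono with hm | hm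
    · exact ⟨1, by simpa using hm⟩
    · refine ⟨-1, fun x hx y hy hxy => ?_⟩
      have := hm hx hy hxy
      simp only; linarith
  set ϑ := tangentAngle κ a with hϑ
  have hϑm := h.tangentAngle_strictMono
  have hϑc := continuous_tangentAngle h.continuous a
  obtain ⟨m, hm, hmϑ⟩ := intermediate_value_Ioo (show a ≤ a + τ by linarith) hϑc.continuousOn
    (show Real.pi / 2 ∈ Ioo (ϑ a) (ϑ (a + τ)) by
      rw [hβ, hϑ, tangentAngle_self]; exact ⟨by linarith [Real.pi_pos], by linarith [Real.pi_pos]⟩)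
  set X : ℝ → ℝ := fun t => (starRingEnd ℂ (v a) * c t).re with hX
  have hua := h.conj_mul_tangent (mem_univ a)
  have hXd : ∀ t, HasDerivAt X (Real.cos (ϑ t)) t := by
    intro t
    refine (hasDerivAt_re ((h.hasDerivAt t (mem_univ t)).const_mul _)).congr_deriv ?_
    rw [h.tangent_eq t, ← mul_assoc, hua, one_mul, Complex.exp_ofReal_mul_I_re]
  have hXa : X a = 0 := by
    have e : starRingEnd ℂ (v a) * c a = -I * starRingEnd ℂ (momentum c v a) := by
      rw [h.eq_conj_momentum_mul (mem_univ a)]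
      linear_combination (-I * starRingEnd ℂ (momentum c v a)) * hua
    rw [hX]; simp only [e]; simp [h.im_left]
  have hXb : X (a + τ) = 0 := by
    have e : starRingEnd ℂ (v a) * c (a + τ) = I * starRingEnd ℂ (momentum c v (a + τ)) := by
      rw [h.eq_conj_momentum_mul (mem_univ (a + τ)), h.tangent_eq (a + τ), ← hϑ, hβ,
        Complex.exp_pi_mul_I]
      linear_combination (I * starRingEnd ℂ (momentum c v (a + τ))) * hua
    rw [hX]; simp only [e]; simp [h.im_right]
  -- The integral of `ε (κ - κ m) cos ϑ`, whose integrand is negative except at the time `m` at which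
  -- `ϑ = π / 2`; the factor `ε = ±1` makes `ε κ` increasing.
  set G : ℝ → ℝ := fun t => ε * (Real.sin (ϑ t) - κ m * X t) with hG
  have hGd : ∀ t, HasDerivAt G ((ε * κ t - ε * κ m) * Real.cos (ϑ t)) t := by
    intro t
    have := (((hasDerivAt_tangentAngle h.continuous a t).sin).sub
      ((hXd t).const_mul (κ m))).const_mul ε
    refine this.congr_deriv ?_
    ring
  have hGc : Continuous G := continuous_iff_continuousAt.mpr fun t => (hGd t).continuousAt
  have hϑa : ϑ a = 0 := by simp [hϑ]
  have h1 : StrictAntiOn G (Icc a m) := by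
    refine strictAntiOn_of_deriv_neg (convex_Icc _ _) hGc.continuousOn fun t ht => ?_
    rw [interior_Icc] at ht
    rw [(hGd t).deriv]
    refine mul_neg_of_neg_of_pos (sub_neg.mpr (hε ⟨ht.1, ht.2.trans hm.2⟩ hm ht.2)) ?_
    have h2 := hϑm ht.1
    have h3 := hϑm ht.2
    refine Real.cos_pos_of_mem_Ioo ⟨?_, ?_⟩ <;> linarith [Real.pi_pos]
  have h2 : StrictAntiOn G (Icc m (a + τ)) := by
    refine strictAntiOn_of_deriv_neg (convex_Icc _ _) hGc.continuousOn fun t ht => ?_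
    rw [interior_Icc] at ht
    rw [(hGd t).deriv]
    refine mul_neg_of_pos_of_neg (sub_pos.mpr (hε hm ⟨hm.1.trans ht.1, ht.2⟩ ht.1)) ?_
    have h2 := hϑm ht.1
    have h3 := hϑm ht.2
    refine Real.cos_neg_of_pi_div_two_lt_of_lt ?_ ?_ <;> linarith [Real.pi_pos]
  have h3 := h1 ⟨le_rfl, hm.1.le⟩ ⟨hm.1.le, le_rfl⟩ hm.1
  have h4 := h2 ⟨le_rfl, hm.2.le⟩ ⟨hm.2.le, le_rfl⟩ hm.2
  have h5 : G a = 0 := by simp [hG, hϑa, hXa]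
  have h6 : G (a + τ) = 0 := by simp only [hG]; rw [hβ, hXb]; simp
  linarith

end IsConvexOscillating

/-! ### Crossings of symmetric branches -/

/-- The polar angle of `c` on `[a, a + τ]`, measured from the direction `-i v(a)`. Here `i z = conj(c) v` has non-negative real part, so
that the principal argument is continuous away from the origin. -/
def polarAngle (κ : ℝ → ℝ) (c v : ℝ → ℂ) (a t : ℝ) : ℝ :=
  tangentAngle κ a t - Complex.arg (I * momentum c v t) + Real.pi / 2

namespace IsOscillating

variable {κ : ℝ → ℝ} {c v : ℝ → ℂ} {a τ : ℝ}

theorem I_mul_momentum_mem_slitPlane (h : IsOscillating κ c v a τ) {t : ℝ} (ht : t ∈ Icc a (a + τ))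
    (h0 : momentum c v t ≠ 0) : I * momentum c v t ∈ slitPlane := by
  have him : (momentum c v t).im ≤ 0 := by
    rcases eq_or_lt_of_le ht.1 with rfl | h1
    · exact h.im_left.le
    rcases eq_or_lt_of_le ht.2 with rfl | h2
    · exact h.im_right.le
    exact (h.im_neg t ⟨h1, h2⟩).le
  rw [mem_slitPlane_iff]
  simp only [mul_re, I_re, zero_mul, I_im, one_mul, zero_sub, mul_im, zero_add]
  rcases eq_or_lt_of_le him with h1 | h1
  · exact Or.inr fun h2 => h0 (Complex.ext h2 h1)
  · exact Or.inl (by linarith)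

theorem hasDerivAt_polarAngle (h : IsOscillating κ c v a τ) {t : ℝ} (ht : t ∈ Icc a (a + τ))
    (h0 : momentum c v t ≠ 0) :
    HasDerivAt (polarAngle κ c v a) ((momentum c v t).re / normSq (momentum c v t)) t := by
  have h1 := ((h.hasDerivAt_momentum (mem_univ t)).const_mul I).clog_real
    (h.I_mul_momentum_mem_slitPlane ht h0)
  have h2 := ((hasDerivAt_tangentAngle h.continuous a t).sub (hasDerivAt_im h1)).add_const
    (Real.pi / 2)
  refine (h2.congr_deriv ?_).congr_of_eventuallyEq
    (Eventually.of_forall fun x => by simp [polarAngle, Complex.log_im])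
  have e : I * (I * κ t * momentum c v t + -I) / (I * momentum c v t)
      = I * κ t - I * (momentum c v t)⁻¹ := by
    field_simp [I_ne_zero]
    ring
  rw [e]
  simp [Complex.inv_re]

theorem continuousOn_polarAngle (h : IsOscillating κ c v a τ) {s : Set ℝ}
    (hs : s ⊆ Icc a (a + τ)) (h0 : ∀ t ∈ s, momentum c v t ≠ 0) :
    ContinuousOn (polarAngle κ c v a) s := fun t ht =>
  (h.hasDerivAt_polarAngle (hs ht) (h0 t ht)).continuousAt.continuousWithinAt

theorem polarAngle_left_of_pos (h : IsOscillating κ c v a τ) (h0 : 0 < (momentum c v a).re) :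
    polarAngle κ c v a a = 0 := by
  have h1 : momentum c v a = ((momentum c v a).re : ℂ) :=
    Complex.ext (by simp) (by simp [h.im_left])
  rw [polarAngle, h1, mul_comm, Complex.arg_real_mul _ h0, Complex.arg_I, tangentAngle_self]
  ring

theorem polarAngle_left_of_neg (h : IsOscillating κ c v a τ) (h0 : (momentum c v a).re < 0) :
    polarAngle κ c v a a = Real.pi := by
  have h1 : I * momentum c v a = ((-(momentum c v a).re : ℝ) : ℂ) * -I := by
    apply Complex.ext
    · simp [h.im_left]
    · simp
  rw [polarAngle, h1, Complex.arg_real_mul _ (neg_pos.mpr h0), Complex.arg_neg_I, tangentAngle_self]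
  ring

/-- The half-period branch and its mirror images meet wherever the polar angle is that of a
symmetry axis. At such a point they are transversal, unless they are radial or orthogonal to the
radius, so the trace is not a topological circle. -/
theorem false_of_polarAngle_eq (h : IsOscillating κ c v a τ)
    (hcirc : Nonempty (range c ≃ₜ Circle)) {t : ℝ} (ht : t ∈ Ioo a (a + τ))
    (hre : (momentum c v t).re ≠ 0) (j : ℕ) (m : ℤ)
    (hj : polarAngle κ c v a t = j * tangentAngle κ a (a + τ) + m * Real.pi) : False := by
  set z := momentum c v t with hz
  set ϑ := tangentAngle κ a t with hϑ
  set β := tangentAngle κ a (a + τ) with hβ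
  -- The time `t'` is the image of `t` under the reflection about `a`, followed by `j` periods.
  set t' := 2 * a - t + j * (2 * τ) with ht'
  have hz' : momentum c v t' = starRingEnd ℂ z := by
    rw [ht', (h.momentum_periodic.nat_mul j) (2 * a - t), h.momentum_left]
  have hϑ' : tangentAngle κ a t' = -ϑ + 2 * (j * β) := by
    rw [ht', h.tangentAngle_add_nat_mul, h.tangentAngle_left]
  have harg : Complex.arg (I * z) = ϑ + Real.pi / 2 - j * β - m * Real.pi := by
    rw [polarAngle, ← hz, ← hϑ] at hj
    linarith
  have hw : I * z = ‖I * z‖ * exp (((ϑ + Real.pi / 2 - j * β - m * Real.pi : ℝ) : ℂ) * I) := by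
    rw [← harg, Complex.norm_mul_exp_arg_mul_I]
  have hwc : -I * starRingEnd ℂ z
      = ‖I * z‖ * exp (-(((ϑ + Real.pi / 2 - j * β - m * Real.pi : ℝ) : ℂ) * I)) := by
    have := congrArg (starRingEnd ℂ) hw
    rw [map_mul, map_mul, conj_I, conj_ofReal, ← Complex.exp_conj, map_mul, conj_ofReal,
      conj_I] at this
    rw [this]; congr 2; ring
  have hmeet : c t = c t' := by
    rw [h.eq_conj_momentum_mul (mem_univ t), h.eq_conj_momentum_mul (mem_univ t'),
      h.tangent_eq t, h.tangent_eq t', ← hz, hz', conj_conj, hϑ', ← hϑ, hwc,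
      show -I * z = -(I * z) by ring, hw]
    have e : exp (-(((ϑ + Real.pi / 2 - j * β - m * Real.pi : ℝ) : ℂ) * I)) * exp (ϑ * I)
        = -(exp (((ϑ + Real.pi / 2 - j * β - m * Real.pi : ℝ) : ℂ) * I)
          * exp (((-ϑ + 2 * (j * β) : ℝ) : ℂ) * I)) := by
      have h1 : (-1 : ℂ) = exp (-(Real.pi * I)) := by
        rw [Complex.exp_neg, Complex.exp_pi_mul_I]; norm_num
      rw [neg_eq_neg_one_mul (exp _ * exp _), h1, ← Complex.exp_add, ← Complex.exp_add,
        ← Complex.exp_add, Complex.exp_eq_exp_iff_exists_int]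
      refine ⟨m, ?_⟩
      push_cast
      ring
    have hn : ‖I * z‖ = ‖z‖ := by rw [norm_mul, norm_I, one_mul]
    rw [norm_mul, norm_mul, norm_I, one_mul, norm_real, norm_norm]
    rw [Complex.norm_exp_ofReal_mul_I, mul_one]
    linear_combination (‖z‖ * v a) * e
  have him := h.im_neg t ht
  have hmom : momentum c v t' = z ∨ momentum c v t' = -z := by
    rcases h.tangent_eq_or_eq_neg hcirc hmeet with h1 | h1
    · left; rw [hz, momentum, momentum, ← hmeet, h1]
    · right; rw [hz, momentum, momentum, ← hmeet, h1]; ring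
  rw [← hz] at him
  rcases hmom with h1 | h1 <;> rw [hz'] at h1
  · have := congrArg Complex.im h1
    simp at this
    linarith
  · have := congrArg Complex.re h1
    simp at this
    exact hre (by linarith)

end IsOscillating

namespace IsConvexOscillating

variable {κ : ℝ → ℝ} {c v : ℝ → ℂ} {a τ : ℝ}

theorem polarAngle_right (h : IsConvexOscillating κ c v a τ) :
    polarAngle κ c v a (a + τ) = tangentAngle κ a (a + τ) := by
  have h1 : momentum c v (a + τ) = ((momentum c v (a + τ)).re : ℂ) :=
    Complex.ext (by simp) (by simp [h.im_right])
  rw [polarAngle, h1, mul_comm, Complex.arg_real_mul _ h.momentum_re_right_pos, Complex.arg_I]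
  ring

/-- If the origin is on one side of the orbit of the momentum, then the half-period turning of a
curve whose trace is a topological circle is `π / n`: otherwise some symmetry axis lies strictly
inside the sector swept out in half a period. -/
theorem exists_nat_mul_eq_pi (h : IsConvexOscillating κ c v a τ)
    (hcirc : Nonempty (range c ≃ₜ Circle)) (h0 : 0 < (momentum c v a).re) :
    ∃ n : ℕ, 2 ≤ n ∧ n * tangentAngle κ a (a + τ) = Real.pi := by
  have hp := h.pos
  have hl : a ∈ Icc a (a + τ) := ⟨le_rfl, by linarith⟩
  have hβ0 := h.tangentAngle_half_pos
  set β := tangentAngle κ a (a + τ) with hβ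
  have hre : ∀ t ∈ Icc a (a + τ), 0 < (momentum c v t).re := fun t ht =>
    h0.trans_le (h.momentum_re_strictMonoOn.monotoneOn hl ht ht.1)
  have hne : ∀ t ∈ Icc a (a + τ), momentum c v t ≠ 0 := fun t ht h1 => by
    have := hre t ht
    rw [h1] at this
    simp at this
  have hcont := h.toIsOscillating.continuousOn_polarAngle subset_rfl hne
  by_contra hno
  push Not at hno
  set N := ⌊Real.pi / β⌋₊ with hN
  have hN1 : N * β ≤ Real.pi := by
    rw [← le_div_iff₀ hβ0]; exact Nat.floor_le (by positivity)
  have hN2 : Real.pi < (N + 1) * β := by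
    rw [← div_lt_iff₀ hβ0]; exact Nat.lt_floor_add_one _
  have hN3 : N * β ≠ Real.pi := by
    intro heq
    have h2 : N < 2 := by
      by_contra hge
      exact hno N (not_lt.mp hge) heq
    interval_cases hNN : N
    · simp at heq; exact Real.pi_ne_zero heq.symm
    · simp at heq; exact h.tangentAngle_half_ne_pi heq
  -- The symmetry axes have the polar angles `j β` modulo `π`; the one with `j = N + 1` lies between
  -- the directions at which the half-period starts and ends.
  obtain ⟨t, ht, hteq⟩ := intermediate_value_Ioo (show a ≤ a + τ by linarith) hcont
    (show (N + 1) * β - Real.pi ∈ Ioo (polarAngle κ c v a a) (polarAngle κ c v a (a + τ)) by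
      rw [h.toIsOscillating.polarAngle_left_of_pos h0, h.polarAngle_right]
      have := lt_of_le_of_ne hN1 hN3
      constructor <;> linarith)
  refine h.toIsOscillating.false_of_polarAngle_eq hcirc ht (hre t ⟨ht.1.le, ht.2.le⟩).ne'
    (N + 1) (-1) ?_
  rw [hteq]; push_cast; ring

/-- If the orbit of the momentum winds around the origin, the curve crosses itself. -/
theorem momentum_re_left_nonneg (h : IsConvexOscillating κ c v a τ)
    (hcirc : Nonempty (range c ≃ₜ Circle)) : 0 ≤ (momentum c v a).re := by
  by_contra hneg
  rw [not_le] at hneg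
  have hp := h.pos
  have hl : a ∈ Icc a (a + τ) := ⟨le_rfl, by linarith⟩
  have hr : a + τ ∈ Icc a (a + τ) := ⟨by linarith, le_rfl⟩
  have hne : ∀ t ∈ Icc a (a + τ), momentum c v t ≠ 0 := fun t ht h1 => by
    rcases eq_or_lt_of_le ht.1 with rfl | h2
    · rw [h1] at hneg; simp at hneg
    · exact h.momentum_ne_zero ⟨h2, ht.2⟩ h1
  have hcont := h.toIsOscillating.continuousOn_polarAngle subset_rfl hne
  have hQa := h.toIsOscillating.polarAngle_left_of_neg hneg
  have hQb := h.polarAngle_right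
  -- The polar angle decreases up to the time `m` at which the curve is radial, then increases.
  obtain ⟨m, hm, hm0⟩ := intermediate_value_Ioo (show a ≤ a + τ by linarith)
    (Complex.continuous_re.comp h.continuous_momentum).continuousOn
    (show (0 : ℝ) ∈ Ioo _ _ from ⟨hneg, h.momentum_re_right_pos⟩)
  simp only [Function.comp] at hm0
  have hmI : m ∈ Icc a (a + τ) := ⟨hm.1.le, hm.2.le⟩
  have hre1 : ∀ t ∈ Ico a m, (momentum c v t).re < 0 := fun t ht => by
    have := h.momentum_re_strictMonoOn ⟨ht.1, ht.2.le.trans hm.2.le⟩ hmI ht.2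
    simpa [hm0] using this
  have hre2 : ∀ t ∈ Ioc m (a + τ), 0 < (momentum c v t).re := fun t ht => by
    have := h.momentum_re_strictMonoOn hmI ⟨hm.1.le.trans ht.1.le, ht.2⟩ ht.1
    simpa [hm0] using this
  have hc1 := hcont.mono (Icc_subset_Icc le_rfl hm.2.le)
  have hc2 := hcont.mono (Icc_subset_Icc hm.1.le le_rfl)
  have hanti : StrictAntiOn (polarAngle κ c v a) (Icc a m) := by
    refine strictAntiOn_of_deriv_neg (convex_Icc _ _) hc1 fun t ht => ?_
    rw [interior_Icc] at ht
    have htI : t ∈ Icc a (a + τ) := ⟨ht.1.le, ht.2.le.trans hm.2.le⟩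
    rw [(h.hasDerivAt_polarAngle htI (hne t htI)).deriv]
    exact div_neg_of_neg_of_pos (hre1 t ⟨ht.1.le, ht.2⟩) (normSq_pos.mpr (hne t htI))
  have hmono : StrictMonoOn (polarAngle κ c v a) (Icc m (a + τ)) := by
    refine strictMonoOn_of_deriv_pos (convex_Icc _ _) hc2 fun t ht => ?_
    rw [interior_Icc] at ht
    have htI : t ∈ Icc a (a + τ) := ⟨hm.1.le.trans ht.1.le, ht.2.le⟩
    rw [(h.hasDerivAt_polarAngle htI (hne t htI)).deriv]
    exact div_pos (hre2 t ⟨ht.1, ht.2.le⟩) (normSq_pos.mpr (hne t htI))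
  have h1 := hanti ⟨le_rfl, hm.1.le⟩ ⟨hm.1.le, le_rfl⟩ hm.1
  have h2 := hmono ⟨le_rfl, hm.2.le⟩ ⟨hm.2.le, le_rfl⟩ hm.2
  rw [hQa] at h1
  rw [hQb] at h2
  -- If `β < π`, the decreasing part meets the axis at the angle `β`; if `β > π`, the increasing part
  -- meets the axis at the angle `π`.
  rcases lt_trichotomy (tangentAngle κ a (a + τ)) Real.pi with hlt | heq | hgt
  · obtain ⟨t, ht, hteq⟩ := intermediate_value_Ioo' hm.1.le hc1
      (show tangentAngle κ a (a + τ) ∈ Ioo _ _ from ⟨h2, by rw [hQa]; exact hlt⟩)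
    exact h.toIsOscillating.false_of_polarAngle_eq hcirc ⟨ht.1, ht.2.trans hm.2⟩
      (hre1 t ⟨ht.1.le, ht.2⟩).ne 1 0 (by rw [hteq]; simp)
  · exact h.tangentAngle_half_ne_pi heq
  · obtain ⟨t, ht, hteq⟩ := intermediate_value_Ioo hm.2.le hc2
      (show Real.pi ∈ Ioo _ _ from ⟨h1, by rw [hQb]; exact hgt⟩)
    exact h.toIsOscillating.false_of_polarAngle_eq hcirc ⟨hm.1.trans ht.1, ht.2⟩
      (hre2 t ⟨ht.1, ht.2.le⟩).ne' 0 1 (by rw [hteq]; simp)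

/-- If the curve passes through the origin, its trace is not a topological circle. -/
theorem momentum_re_left_ne_zero (h : IsConvexOscillating κ c v a τ)
    (hcirc : Nonempty (range c ≃ₜ Circle)) : (momentum c v a).re ≠ 0 := by
  intro h0
  have hp := h.pos
  have hl : a ∈ Icc a (a + τ) := ⟨le_rfl, by linarith⟩
  have hr : a + τ ∈ Icc a (a + τ) := ⟨by linarith, le_rfl⟩
  have hza : momentum c v a = 0 := Complex.ext h0 h.im_left
  have hre : ∀ t ∈ Ioc a (a + τ), 0 < (momentum c v t).re := fun t ht => by
    have := h.momentum_re_strictMonoOn hl ⟨ht.1.le, ht.2⟩ ht.1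
    simpa [h0] using this
  have hmono : StrictMonoOn (polarAngle κ c v a) (Ioc a (a + τ)) := by
    refine strictMonoOn_of_deriv_pos (convex_Ioc _ _)
      (h.toIsOscillating.continuousOn_polarAngle Ioc_subset_Icc_self
        fun t ht => h.momentum_ne_zero ht) fun t ht => ?_
    rw [interior_Ioc] at ht
    have hz := h.momentum_ne_zero ⟨ht.1, ht.2.le⟩
    rw [(h.hasDerivAt_polarAngle ⟨ht.1.le, ht.2.le⟩ hz).deriv]
    exact div_pos (hre t ⟨ht.1, ht.2.le⟩) (normSq_pos.mpr hz)
  -- At its start from the origin the curve is tangent to the ray of polar angle `π / 2`.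
  have hlim : Tendsto (polarAngle κ c v a) (𝓝[>] a) (𝓝 (Real.pi / 2)) := by
    have hd : HasDerivAt (momentum c v) (-I) a := by
      have := h.hasDerivAt_momentum (mem_univ a)
      rw [hza] at this
      simpa using this
    have h1 : Tendsto (fun t => I * slope (momentum c v) a t) (𝓝[>] a) (𝓝 1) := by
      have := (hasDerivAt_iff_tendsto_slope.mp hd).const_mul I
      rw [mul_neg, I_mul_I, neg_neg] at this
      exact this.mono_left (nhdsWithin_mono _ fun x hx => (ne_of_gt hx : x ≠ a))
    have h2 : Tendsto (fun t => Complex.arg (I * slope (momentum c v) a t)) (𝓝[>] a) (𝓝 0) := by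
      have := (Complex.continuousAt_arg (x := 1) (by simp)).tendsto.comp h1
      rwa [Complex.arg_one] at this
    have h3 : Tendsto (tangentAngle κ a) (𝓝[>] a) (𝓝 0) := by
      have := (continuous_tangentAngle h.continuous a).continuousAt.tendsto (x := a)
      rw [tangentAngle_self] at this
      exact this.mono_left nhdsWithin_le_nhds
    have h4 := (h3.sub h2).add_const (Real.pi / 2)
    rw [sub_zero, zero_add] at h4
    refine h4.congr' ?_
    filter_upwards [self_mem_nhdsWithin] with t ht
    have hta : 0 < (t - a)⁻¹ := inv_pos.mpr (sub_pos.mpr ht)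
    rw [polarAngle, slope_def_module, hza, sub_zero, Complex.real_smul, mul_left_comm,
      Complex.arg_real_mul _ hta]
  have hgt : ∀ t ∈ Ioc a (a + τ), Real.pi / 2 < polarAngle κ c v a t := by
    intro t ht
    set s := (a + t) / 2 with hs
    have hs1 : s ∈ Ioc a (a + τ) := ⟨by linarith [ht.1], by linarith [ht.1, ht.2]⟩
    have hst : s < t := by linarith [ht.1]
    refine lt_of_le_of_lt (le_of_tendsto hlim ?_) (hmono hs1 ht hst)
    filter_upwards [Ioo_mem_nhdsGT hs1.1] with x hx
    exact (hmono ⟨hx.1, hx.2.le.trans hs1.2⟩ hs1 hx.2).le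
  have hQb := h.polarAngle_right
  have hβ := hgt (a + τ) ⟨by linarith, le_rfl⟩
  rw [hQb] at hβ
  rcases lt_trichotomy (tangentAngle κ a (a + τ)) Real.pi with hlt | heq | hlt
  · -- The two passages through the origin, one period apart, are not tangent.
    have hca : c a = 0 := (h.momentum_eq_zero_iff (mem_univ a)).mp hza
    have hcb : c (a + 2 * τ) = 0 := by
      rw [← h.momentum_eq_zero_iff (mem_univ _), h.momentum_periodic a, hza]
    have hv := h.tangent_eq (a + 2 * τ)
    rw [h.tangentAngle_add_period, tangentAngle_self, zero_add] at hv
    have hva : v a ≠ 0 := fun h1 => by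
      have := h.norm_tangent a (mem_univ a)
      rw [h1, norm_zero] at this
      exact zero_ne_one this
    have hsin : Real.sin (2 * tangentAngle κ a (a + τ)) = 0 := by
      rw [← Complex.exp_ofReal_mul_I_im]
      rcases h.tangent_eq_or_eq_neg hcirc (hca.trans hcb.symm) with h1 | h1
      · rw [h1] at hv
        rw [mul_left_cancel₀ hva (hv.symm.trans (mul_one _).symm)]; simp
      · rw [h1] at hv
        rw [mul_left_cancel₀ hva (hv.symm.trans (mul_neg_one _).symm)]; simp
    have hneg : Real.sin (2 * tangentAngle κ a (a + τ) - 2 * Real.pi) < 0 :=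
      Real.sin_neg_of_neg_of_neg_pi_lt (by linarith) (by linarith)
    rw [Real.sin_sub_two_pi] at hneg
    exact hneg.ne hsin
  · exact h.tangentAngle_half_ne_pi heq
  · have hev : ∀ᶠ t in 𝓝[>] a, polarAngle κ c v a t < Real.pi :=
      hlim.eventually_lt_const (by linarith [Real.pi_pos])
    obtain ⟨s, hs, hsI⟩ := (hev.and (Ioo_mem_nhdsGT (show a < a + τ by linarith))).exists
    obtain ⟨t, ht, hteq⟩ := intermediate_value_Ioo hsI.2.le
      (h.toIsOscillating.continuousOn_polarAngle (fun t ht => ⟨hsI.1.le.trans ht.1, ht.2⟩)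
        fun t ht => h.momentum_ne_zero ⟨hsI.1.trans_le ht.1, ht.2⟩)
      (show Real.pi ∈ Ioo _ _ from ⟨hs, by rw [hQb]; exact hlt⟩)
    exact h.toIsOscillating.false_of_polarAngle_eq hcirc ⟨hsI.1.trans ht.1, ht.2⟩
      (hre t ⟨hsI.1.trans ht.1, ht.2.le⟩).ne' 0 1 (by rw [hteq]; simp)

/-- The real part of the momentum is positive throughout if it is positive at its minimum. -/
theorem momentum_re_pos (h : IsConvexOscillating κ c v a τ) (h0 : 0 < (momentum c v a).re)
    (t : ℝ) : 0 < (momentum c v t).re := by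
  obtain ⟨s, hs, hz⟩ := h.toIsOscillating.exists_reduced t
  have hs' : 0 < (momentum c v s).re :=
    h0.trans_le (h.momentum_re_strictMonoOn.monotoneOn ⟨le_rfl, by linarith [h.pos]⟩ hs hs.1)
  rcases hz with hz | hz <;> rw [hz]
  · exact hs'
  · simpa using hs'

/-- Classification of the oscillating curves whose trace is a topological circle. -/
theorem of_range_homeomorph_circle (h : IsConvexOscillating κ c v a τ)
    (hcirc : Nonempty (range c ≃ₜ Circle)) :
    (∀ t, 0 < (momentum c v t).re) ∧
      ∃ n : ℕ, 2 ≤ n ∧ n * tangentAngle κ a (a + τ) = Real.pi := by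
  have h0 : 0 < (momentum c v a).re :=
    lt_of_le_of_ne (h.momentum_re_left_nonneg hcirc) (h.momentum_re_left_ne_zero hcirc).symm
  exact ⟨h.momentum_re_pos h0, h.exists_nat_mul_eq_pi hcirc h0⟩

end IsConvexOscillating

/-! ### Extension by reflection -/

namespace UnitSpeedPath

variable {c : UnitSpeedPath} {f : ℝ → ℝ}

/-- A solution is symmetric about every critical time `b` of its distance from the origin. -/
theorem IsSolution.eventually_curvature_reflect (hc : c.IsSolution f)
    (hf : ContDiffOn ℝ ∞ f (Ioi 0)) {b : ℝ} (hb : b ∈ c.J) (hbz : (c.assoc b).im = 0) :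
    ∃ δ > 0, Ioo (b - δ) (b + δ) ⊆ c.J ∧
      ∀ t ∈ Ioo (b - δ) (b + δ), c.curvature (2 * b - t) = c.curvature t := by
  obtain ⟨δ, hδ, hball⟩ := Metric.isOpen_iff.mp c.isOpen_J b hb
  rw [Real.ball_eq_Ioo] at hball
  have hrefl : ∀ t ∈ Ioo (b - δ) (b + δ), 2 * b - t ∈ Ioo (b - δ) (b + δ) := fun t ht =>
    ⟨by linarith [ht.2], by linarith [ht.1]⟩
  have h2 : ∀ t ∈ Ioo (b - δ) (b + δ), HasDerivAt (fun t => starRingEnd ℂ (c.assoc (2 * b - t)))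
      (field f (starRingEnd ℂ (c.assoc (2 * b - t)))) t := by
    intro t ht
    have h1 := (hc.hasDerivAt_assoc (hball (hrefl t ht))).scomp t
      ((hasDerivAt_id t).const_sub (2 * b))
    refine (hasDerivAt_conj h1).congr_deriv ?_
    simp [field]
    ring
  have hz := eqOn_of_integralCurve isPreconnected_Ioo isOpen_Ioo
    (fun t ht => hc.lipNear hf (hball ht)) (fun t ht => hc.hasDerivAt_assoc (hball ht)) h2
    (show b ∈ Ioo (b - δ) (b + δ) from ⟨by linarith, by linarith⟩)
    (by rw [show 2 * b - b = b by ring]; exact (Complex.conj_eq_iff_im.mpr hbz).symm)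
  refine ⟨δ, hδ, hball, fun t ht => ?_⟩
  have hn : ∀ x ∈ Ioo (b - δ) (b + δ), ‖c.toFun (2 * b - x)‖ = ‖c.toFun x‖ := by
    intro x hx
    rw [← c.isArc.norm_momentum (hball hx), ← c.isArc.norm_momentum (hball (hrefl x hx)),
      ← c.assoc_eq_momentum, show c.assoc x = _ from hz hx, RCLike.norm_conj]
  refine (c.isArc.curvature_eq_of_eventually (κ' := fun x => c.curvature (2 * b - x)) (hball ht)
    (c.continuousAt_curvature (hball ht)) ?_ ?_).symm
  · exact (c.continuousAt_curvature (hball (hrefl t ht))).comp (by fun_prop)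
  · filter_upwards [isOpen_Ioo.mem_nhds ht] with x hx hx0
    have hx0' : c.toFun (2 * b - x) ≠ 0 := by
      rw [← norm_ne_zero_iff, hn x hx]; exact norm_ne_zero_iff.mpr hx0
    rw [hc x (hball hx) hx0, hc _ (hball (hrefl x hx)) hx0', hn x hx]

/-- The curvature of a solution between two critical times of its distance from the origin extends
to a smooth function on the line that is symmetric about both times. -/
theorem IsSolution.exists_curvature_extension (hc : c.IsSolution f)
    (hf : ContDiffOn ℝ ∞ f (Ioi 0)) {a b : ℝ} (ha : a ∈ c.J) (hb : b ∈ c.J) (hab : a < b)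
    (haz : (c.assoc a).im = 0) (hbz : (c.assoc b).im = 0) :
    ∃ K : ℝ → ℝ, ContDiff ℝ ∞ K ∧ (∀ t, K (2 * a - t) = K t) ∧ (∀ t, K (2 * b - t) = K t) ∧
      ∃ δ > 0, Ioo (a - δ) (b + δ) ⊆ c.J ∧ ∀ t ∈ Ioo (a - δ) (b + δ), K t = c.curvature t := by
  set τ := b - a with hτ
  have hτ0 : 0 < τ := by linarith
  have hbτ : b = a + τ := by linarith
  -- The distance of `t - a` to the lattice of periods is a triangular wave with values in `[0, τ]`.
  set K : ℝ → ℝ := fun t => c.curvature (a + ‖((t - a : ℝ) : AddCircle (2 * τ))‖) with hK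
  have hKa : ∀ t, K (2 * a - t) = K t := by
    intro t
    simp only [hK]
    rw [show 2 * a - t - a = -(t - a) by ring, AddCircle.coe_neg, norm_neg]
  have hKp : Function.Periodic K (2 * τ) := by
    intro t
    simp only [hK]
    rw [show t + 2 * τ - a = (t - a) + 2 * τ by ring, AddCircle.coe_add_period]
  have hKb : ∀ t, K (2 * b - t) = K t := by
    intro t
    rw [show 2 * b - t = (2 * a - t) + 2 * τ by linarith, hKp, hKa]
  have hKI : ∀ t ∈ Icc a b, K t = c.curvature t := by
    intro t ht
    have h1 : ‖((t - a : ℝ) : AddCircle (2 * τ))‖ = |t - a| := by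
      rw [AddCircle.norm_coe_eq_abs_iff _ (by linarith), abs_of_nonneg (by linarith [ht.1]),
        abs_of_pos (by linarith)]
      linarith [ht.2]
    simp only [hK]
    rw [h1, abs_of_nonneg (by linarith [ht.1])]
    congr 1; ring
  obtain ⟨δ₁, hδ₁, hJ₁, hs₁⟩ := hc.eventually_curvature_reflect hf ha haz
  obtain ⟨δ₂, hδ₂, hJ₂, hs₂⟩ := hc.eventually_curvature_reflect hf hb hbz
  set δ := min τ (min δ₁ δ₂) with hδ
  have hδ0 : 0 < δ := lt_min hτ0 (lt_min hδ₁ hδ₂)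
  have hδτ : δ ≤ τ := min_le_left _ _
  have hδδ₁ : δ ≤ δ₁ := (min_le_right _ _).trans (min_le_left _ _)
  have hδδ₂ : δ ≤ δ₂ := (min_le_right _ _).trans (min_le_right _ _)
  have hKJ : ∀ t ∈ Ioo (a - δ) (b + δ), t ∈ c.J ∧ K t = c.curvature t := by
    intro t ht
    rcases lt_or_ge t a with h1 | h1
    · have htI : t ∈ Ioo (a - δ₁) (a + δ₁) := ⟨by linarith [ht.1], by linarith⟩
      refine ⟨hJ₁ htI, ?_⟩
      rw [← hs₁ t htI, ← hKa]
      exact hKI _ ⟨by linarith, by linarith [ht.1]⟩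
    rcases lt_or_ge b t with h2 | h2
    · have htI : t ∈ Ioo (b - δ₂) (b + δ₂) := ⟨by linarith, by linarith [ht.2]⟩
      refine ⟨hJ₂ htI, ?_⟩
      rw [← hs₂ t htI, ← hKb]
      exact hKI _ ⟨by linarith [ht.2], by linarith⟩
    · exact ⟨c.ordConnected_J.out ha hb ⟨h1, h2⟩, hKI t ⟨h1, h2⟩⟩
  have hsm : ∀ t ∈ Ioo (a - δ) (b + δ), ContDiffAt ℝ ∞ K t := by
    intro t ht
    refine (c.contDiffOn_curvature.contDiffAt
      (c.isOpen_J.mem_nhds (hKJ t ht).1)).congr_of_eventuallyEq ?_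
    filter_upwards [isOpen_Ioo.mem_nhds ht] with x hx using (hKJ x hx).2
  refine ⟨K, contDiff_iff_contDiffAt.mpr fun t => ?_, hKa, hKb, δ, hδ0, fun t ht => (hKJ t ht).1,
    fun t ht => (hKJ t ht).2⟩
  obtain ⟨s, hs, k, h | h⟩ := exists_reflection_reduced hτ0 a t
  · have h1 : ContDiffAt ℝ ∞ K (t - k * (2 * τ)) := by
      rw [h, add_sub_cancel_right]; exact hsm s ⟨by linarith [hs.1], by linarith [hs.2]⟩
    have h2 : K = fun x => K (x - k * (2 * τ)) := funext fun x => (hKp.sub_int_mul_eq k).symm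
    rw [h2]
    exact ContDiffAt.comp (g := K) t h1 (by fun_prop)
  · have h1 : ContDiffAt ℝ ∞ K (2 * a - t + k * (2 * τ)) := by
      rw [show 2 * a - t + k * (2 * τ) = s by rw [h]; ring]
      exact hsm s ⟨by linarith [hs.1], by linarith [hs.2]⟩
    have h2 : K = fun x => K (2 * a - x + k * (2 * τ)) := funext fun x => by
      rw [(hKp.int_mul k) (2 * a - x), hKa]
    rw [h2]
    exact ContDiffAt.comp (g := K) t h1 (by fun_prop)

/-- A solution that contains a stretch between two consecutive critical times of its distance from
the origin extends to an oscillating arc on the whole line. -/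
theorem IsSolution.exists_oscillating_extension (hc : c.IsSolution f)
    (hf : ContDiffOn ℝ ∞ f (Ioi 0)) {a b : ℝ} (ha : a ∈ c.J) (hb : b ∈ c.J) (hab : a < b)
    (haz : (c.assoc a).im = 0) (hbz : (c.assoc b).im = 0)
    (hne : ∀ t ∈ Ioo a b, (c.assoc t).im ≠ 0) :
    ∃ (κ : ℝ → ℝ) (γ v : ℝ → ℂ) (a' τ : ℝ), IsOscillating κ γ v a' τ ∧ ContDiff ℝ ∞ κ ∧
      (∀ t, γ t ≠ 0 → κ t = f ‖γ t‖) ∧ EqOn γ c.toFun c.J ∧ EqOn v (deriv c.toFun) c.J := by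
  obtain ⟨K, hKs, hKa, hKb, δ, hδ, hδJ, hKδ⟩ :=
    hc.exists_curvature_extension hf ha hb hab haz hbz
  have hKc := hKs.continuous
  set v : ℝ → ℂ := fun t => deriv c.toFun a * exp (tangentAngle K a t * I) with hv
  have hvd : ∀ t, HasDerivAt v (I * K t * v t) t := fun t => hasDerivAt_exp_tangentAngle hKc a t _
  have hvc : Continuous v := continuous_iff_continuousAt.mpr fun t => (hvd t).continuousAt
  have hva : v a = deriv c.toFun a := by simp [hv]
  set γ : ℝ → ℂ := fun t => c.toFun a + ∫ s in a..t, v s with hγ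
  have hγa : γ a = c.toFun a := by simp [hγ]
  have harc : IsArc univ K γ v :=
    { hasDerivAt := fun t _ => (intervalIntegral.integral_hasDerivAt_right
        (hvc.intervalIntegrable _ _) (hvc.stronglyMeasurableAtFilter _ _)
        hvc.continuousAt).const_add _
      hasDerivAt_tangent := fun t _ => hvd t
      norm_tangent := fun t _ => by
        rw [hv, norm_mul, Complex.norm_exp_ofReal_mul_I, mul_one]; exact c.unit_speed a ha }
  have hmoma : momentum γ v a = c.assoc a := by
    rw [assoc_eq_momentum, momentum, momentum, hγa, hva]
  have haI : a ∈ Ioo (a - δ) (b + δ) := ⟨by linarith, by linarith⟩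
  have hsub : Icc a b ⊆ Ioo (a - δ) (b + δ) := fun t ht => ⟨by linarith [ht.1], by linarith [ht.2]⟩
  have hmomI : EqOn (momentum γ v) c.assoc (Ioo (a - δ) (b + δ)) := by
    refine eqOn_of_linear isPreconnected_Ioo isOpen_Ioo
      (fun t _ => harc.hasDerivAt_momentum (mem_univ t)) (fun t ht => ?_) haI hmoma
    rw [hKδ t ht]
    exact c.isArc.hasDerivAt_momentum (hδJ ht)
  have hra := harc.momentum_reflect hKa (by rw [hmoma, haz])
  have hrb := harc.momentum_reflect hKb (by rw [hmomI (hsub ⟨hab.le, le_rfl⟩), hbz])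
  have hperK : Function.Periodic K (2 * (b - a)) := fun t => by
    rw [show t + 2 * (b - a) = 2 * b - (2 * a - t) by ring, hKb, hKa]
  have hperz : Function.Periodic (momentum γ v) (2 * (b - a)) := fun t => by
    rw [show t + 2 * (b - a) = 2 * b - (2 * a - t) by ring, hrb, hra, conj_conj]
  have hnorm : ∀ t, γ t ≠ 0 → K t = f ‖γ t‖ := by
    intro t ht
    have hkey : ∃ s ∈ Icc a b, K t = K s ∧ ‖γ t‖ = ‖γ s‖ := by
      obtain ⟨s, hs, k, h | h⟩ := exists_reflection_reduced (show 0 < b - a by linarith) a t <;>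
        refine ⟨s, ⟨hs.1, by linarith [hs.2]⟩, ?_, ?_⟩
      · rw [h, (hperK.int_mul k) s]
      · rw [← harc.norm_momentum (mem_univ t), ← harc.norm_momentum (mem_univ s), h,
          (hperz.int_mul k) s]
      · rw [h, (hperK.int_mul k) (2 * a - s), hKa]
      · rw [← harc.norm_momentum (mem_univ t), ← harc.norm_momentum (mem_univ s), h,
          (hperz.int_mul k) (2 * a - s), hra, RCLike.norm_conj]
    obtain ⟨s, hs, hKs, hns⟩ := hkey
    have hs' := hsub hs
    have hcs : ‖γ s‖ = ‖c.toFun s‖ := by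
      rw [← harc.norm_momentum (mem_univ s), hmomI hs', assoc_eq_momentum,
        c.isArc.norm_momentum (hδJ hs')]
    rw [hKs, hns, hKδ s hs', hcs]
    refine hc s (hδJ hs') ?_
    rw [← norm_ne_zero_iff, ← hcs, ← hns]
    exact norm_ne_zero_iff.mpr ht
  have hmomJ : EqOn c.assoc (momentum γ v) c.J :=
    eqOn_of_integralCurve c.isPreconnected_J c.isOpen_J (fun t ht => hc.lipNear hf ht)
      (fun t ht => hc.hasDerivAt_assoc ht)
      (fun t _ => harc.hasDerivAt_momentum_field (mem_univ t) (hnorm t)) ha hmoma.symm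
  have hnJ : ∀ t ∈ c.J, ‖c.toFun t‖ = ‖γ t‖ := fun t ht => by
    rw [← c.isArc.norm_momentum ht, ← assoc_eq_momentum, hmomJ ht, harc.norm_momentum (mem_univ t)]
  have hKJ : ∀ t ∈ c.J, c.curvature t = K t := by
    intro t ht
    refine c.isArc.curvature_eq_of_eventually ht (c.continuousAt_curvature ht) hKc.continuousAt ?_
    filter_upwards [c.isOpen_J.mem_nhds ht] with x hx hx0
    have hx0' : γ x ≠ 0 := by
      rw [← norm_ne_zero_iff, ← hnJ x hx]; exact norm_ne_zero_iff.mpr hx0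
    rw [hc x hx hx0, hnorm x hx0', hnJ x hx]
  have hvJ : EqOn v (deriv c.toFun) c.J :=
    eqOn_of_linear (β := 0) c.isPreconnected_J c.isOpen_J (fun t _ => by simpa using hvd t)
      (fun t ht => by simpa [hKJ t ht] using c.isArc.hasDerivAt_tangent t ht) ha hva
  have hγJ : EqOn γ c.toFun c.J := fun t ht => by
    rw [harc.eq_conj_momentum_mul (mem_univ t), c.isArc.eq_conj_momentum_mul ht, hvJ ht,
      ← hmomJ ht, assoc_eq_momentum]
  have himc : ContinuousOn (fun t => (momentum γ v t).im) (Ioo a b) := fun t _ =>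
    (Complex.continuous_im.continuousAt.comp
      (harc.hasDerivAt_momentum (mem_univ t)).continuousAt).continuousWithinAt
  have hne' : ∀ t ∈ Ioo a b, (momentum γ v t).im ≠ 0 := fun t ht => by
    rw [hmomI (hsub ⟨ht.1.le, ht.2.le⟩)]; exact hne t ht
  have himb : (momentum γ v b).im = 0 := by rw [hmomI (hsub ⟨hab.le, le_rfl⟩), hbz]
  have hsign : (∀ t ∈ Ioo a b, (momentum γ v t).im < 0) ∨
      ∀ t ∈ Ioo a b, 0 < (momentum γ v t).im := by
    by_contra hcon
    push Not at hcon
    obtain ⟨⟨s, hs, hs0⟩, ⟨t, ht, ht0⟩⟩ := hcon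
    obtain ⟨x, hx, hx0⟩ := isPreconnected_Ioo.intermediate_value ht hs himc
      (show (0 : ℝ) ∈ Icc _ _ from ⟨ht0, hs0⟩)
    exact hne' x hx hx0
  rcases hsign with hneg | hpos
  · have hb' : a + (b - a) = b := by ring
    refine ⟨K, γ, v, a, b - a, ?_, hKs, hnorm, hγJ, hvJ⟩
    exact { harc with
            continuous := hKc
            pos := by linarith
            symm_left := hKa
            symm_right := by rw [hb']; exact hKb
            im_left := by rw [hmoma, haz]
            im_right := by rw [hb', himb]
            im_neg := by rw [hb']; exact hneg }
  · refine ⟨K, γ, v, b, b - a, ?_, hKs, hnorm, hγJ, hvJ⟩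
    exact { harc with
            continuous := hKc
            pos := by linarith
            symm_left := hKb
            symm_right := fun t => by
              rw [show 2 * (b + (b - a)) - t = (2 * b - t) + 2 * (b - a) by ring, hperK, hKb]
            im_left := himb
            im_right := by
              rw [show b + (b - a) = 2 * b - a by ring, hrb, conj_im, hmoma, haz, neg_zero]
            im_neg := fun t ht => by
              have := hpos (2 * b - t) ⟨by linarith [ht.2], by linarith [ht.1]⟩
              rw [hrb, conj_im] at this
              linarith }

end UnitSpeedPath

/-! ### Net winding of the orbit of an oscillating arc -/

/-- An orbit that stays in an open half-plane bounded by the imaginary axis is untwisted. -/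
theorem untwisted_of_re_pos {f : ℝ → ℝ} {p : ℂ} (hp : p ∈ Per f) {ε : ℝ} (hε : ε ≠ 0)
    (h : ∀ t, 0 < ε * (flow f t p).re) : Untwisted f p := by
  refine ⟨hp, fun hb => ?_⟩
  set R : Set ℂ := (fun s : ℝ => ((-(ε * s) : ℝ) : ℂ)) '' Ici 0 with hR
  have hRconn : IsPreconnected R := isPreconnected_Ici.image _
    (by fun_prop : Continuous fun s : ℝ => ((-(ε * s) : ℝ) : ℂ)).continuousOn
  have hR0 : (0 : ℂ) ∈ R := ⟨0, by simp, by simp⟩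
  have hRsub : R ⊆ (orbit f p)ᶜ := by
    rintro _ ⟨s, hs, rfl⟩ ⟨t, ht⟩
    have h1 := h t
    simp only at ht
    rw [ht, ofReal_re] at h1
    have h2 : 0 ≤ ε ^ 2 * s := mul_nonneg (sq_nonneg _) hs
    nlinarith
  have hRb := hb.subset (hRconn.subset_connectedComponentIn hR0 hRsub)
  obtain ⟨B, hB⟩ := isBounded_iff_forall_norm_le.mp hRb
  have h1 := hB _ ⟨(|B| + 1) / |ε|, by simp only [mem_Ici]; positivity, rfl⟩
  rw [norm_real, Real.norm_eq_abs, abs_neg, abs_mul, abs_div, abs_abs,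
    mul_div_cancel₀ _ (abs_ne_zero.mpr hε), abs_of_nonneg (by positivity)] at h1
  linarith [le_abs_self B]

/-- A solution of `κ = f(r)` on the whole line such that the field is locally Lipschitz along its
momentum. -/
structure IsSolutionArc (f κ : ℝ → ℝ) (c v : ℝ → ℂ) : Prop extends IsArc univ κ c v where
  curvature_eq : ∀ t, c t ≠ 0 → κ t = f ‖c t‖
  lipNear : ∀ t, LipNear (field f) (momentum c v t)

namespace IsSolutionArc

variable {f κ : ℝ → ℝ} {c v : ℝ → ℂ} {a τ : ℝ}

theorem hasDerivAt_momentum_eq_field (h : IsSolutionArc f κ c v) (t : ℝ) :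
    HasDerivAt (momentum c v) (field f (momentum c v t)) t :=
  h.hasDerivAt_momentum_field (mem_univ t) (h.curvature_eq t)

theorem isTrajectory (h : IsSolutionArc f κ c v) : IsTrajectory f (momentum c v) where
  continuous := continuous_iff_continuousAt.mpr fun t =>
    (h.hasDerivAt_momentum (mem_univ t)).continuousAt
  ode t _ := h.hasDerivAt_momentum_eq_field t
  dense t := by
    rw [mem_closure_iff_frequently]
    have h1 : ∀ᶠ x in 𝓝[≠] t, momentum c v x ≠ 0 := by
      filter_upwards [h.eventually_ne_zero (mem_univ t)] with x hx
      rwa [Ne, h.momentum_eq_zero_iff (mem_univ x)]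
    exact h1.frequently.filter_mono nhdsWithin_le_nhds

theorem flow_eq (h : IsSolutionArc f κ c v) (t : ℝ) :
    flow f t (momentum c v 0) = momentum c v t :=
  flow_eq_of_integralCurve h.hasDerivAt_momentum_eq_field h.lipNear h.isTrajectory t

/-- A return of the momentum to its initial value is a period. -/
theorem periodic_of_eq (h : IsSolutionArc f κ c v) {p : ℝ}
    (hp : momentum c v p = momentum c v 0) : Function.Periodic (momentum c v) p := by
  intro t
  have h2 : ∀ t ∈ univ, HasDerivAt (fun t => momentum c v (t + p))
      (field f (momentum c v (t + p))) t := fun t _ =>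
    (h.hasDerivAt_momentum_eq_field (t + p)).comp_add_const t p
  exact (eqOn_of_integralCurve isPreconnected_univ isOpen_univ (fun t _ => h.lipNear t)
    (fun t _ => h.hasDerivAt_momentum_eq_field t) h2 (mem_univ 0) (by simp [hp]) (mem_univ t)).symm

/-- The minimal period of the momentum is twice the time between consecutive critical times. -/
theorem isLeast_period (h : IsSolutionArc f κ c v) (ho : IsOscillating κ c v a τ) :
    IsLeast {t : ℝ | 0 < t ∧ flow f t (momentum c v 0) = momentum c v 0} (2 * τ) := by
  have hτ := ho.pos
  constructor
  · refine ⟨by linarith, ?_⟩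
    rw [h.flow_eq]
    simpa using ho.momentum_periodic 0
  · rintro t ⟨ht0, ht⟩
    by_contra hlt
    rw [not_le] at hlt
    rw [h.flow_eq] at ht
    have hat := h.periodic_of_eq ht a
    have hl : a ∈ Icc a (a + τ) := ⟨le_rfl, by linarith⟩
    have hkey : ∃ s ∈ Ioc a (a + τ), ‖c s‖ = ‖c a‖ := by
      rcases le_total t τ with h1 | h1
      · refine ⟨a + t, ⟨by linarith, by linarith⟩, ?_⟩
        rw [← h.norm_momentum (mem_univ (a + t)), hat, h.norm_momentum (mem_univ a)]
      · refine ⟨2 * (a + τ) - (a + t), ⟨by linarith, by linarith⟩, ?_⟩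
        rw [← h.norm_momentum (mem_univ _), ho.momentum_right, RCLike.norm_conj, hat,
          h.norm_momentum (mem_univ a)]
    obtain ⟨s, hs, hsn⟩ := hkey
    exact (ho.norm_strictMonoOn hl ⟨hs.1.le, hs.2⟩ hs.1).ne' hsn

theorem period_eq (h : IsSolutionArc f κ c v) (ho : IsOscillating κ c v a τ) :
    period f (momentum c v 0) = 2 * τ :=
  (h.isLeast_period ho).csInf_eq

theorem mem_Per (h : IsSolutionArc f κ c v) (ho : IsOscillating κ c v a τ) :
    momentum c v 0 ∈ Per f :=
  ⟨2 * τ, (h.isLeast_period ho).1⟩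

/-- By partial integration, the signed area of the orbit is `∮ κ y² dt`. -/
theorem signedArea_eq (h : IsSolutionArc f κ c v) (ho : IsOscillating κ c v a τ) :
    signedArea f (momentum c v 0) = ∫ t in (0 : ℝ)..2 * τ, κ t * (momentum c v t).im ^ 2 := by
  have hzc := ho.continuous_momentum
  have hκc := ho.continuous
  have hxc := Complex.continuous_re.comp hzc
  have hyc := Complex.continuous_im.comp hzc
  simp only [Function.comp_def] at hxc hyc
  have hint : ∀ t, (starRingEnd ℂ (flow f t (momentum c v 0)) *
      deriv (fun u => flow f u (momentum c v 0)) t).im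
      = 2 * (κ t * (momentum c v t).im ^ 2) + (-κ t * (momentum c v t).im * (momentum c v t).im
        + (momentum c v t).re * (κ t * (momentum c v t).re - 1)) := by
    intro t
    have h1 : (fun u => flow f u (momentum c v 0)) = momentum c v := funext h.flow_eq
    rw [h1, h.flow_eq, (h.hasDerivAt_momentum (mem_univ t)).deriv]
    simp
    ring
  have hxy : ∫ t in (0 : ℝ)..2 * τ, (-κ t * (momentum c v t).im * (momentum c v t).im
      + (momentum c v t).re * (κ t * (momentum c v t).re - 1)) = 0 := by
    rw [intervalIntegral.integral_eq_sub_of_hasDerivAt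
      (fun t _ => (h.hasDerivAt_momentum_re (mem_univ t)).mul
        (h.hasDerivAt_momentum_im (mem_univ t)))
      (Continuous.intervalIntegrable (by fun_prop) _ _)]
    have := ho.momentum_periodic 0
    rw [zero_add] at this
    simp [this]
  rw [signedArea, h.period_eq ho]
  simp only [hint]
  rw [intervalIntegral.integral_add (Continuous.intervalIntegrable (by fun_prop) _ _)
    (Continuous.intervalIntegrable (by fun_prop) _ _), hxy, intervalIntegral.integral_const_mul]
  ring

/-- The total curvature over a period; the passages through the origin are negligible. -/
theorem integral_norm_flow_eq (h : IsSolutionArc f κ c v) (ho : IsOscillating κ c v a τ) :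
    ∫ t in (0 : ℝ)..period f (momentum c v 0), f ‖flow f t (momentum c v 0)‖
      = 2 * tangentAngle κ a (a + τ) := by
  have hzero : {t | c t = 0} ⊆ range fun k : ℤ => a + k * (2 * τ) := by
    intro t ht
    have hzt : momentum c v t = 0 := (h.momentum_eq_zero_iff (mem_univ t)).mpr ht
    obtain ⟨s, hs, k, hk⟩ := exists_reflection_reduced ho.pos a t
    have hzs : momentum c v s = 0 := by
      rcases hk with hk | hk
      · rw [hk, (ho.momentum_periodic.int_mul k) s] at hzt; exact hzt
      · rw [hk, (ho.momentum_periodic.int_mul k) (2 * a - s), ho.momentum_left] at hzt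
        simpa using hzt
    have hsa : s = a := by
      by_contra hne
      exact ho.momentum_ne_zero ⟨lt_of_le_of_ne hs.1 (Ne.symm hne), hs.2⟩ hzs
    refine ⟨k, ?_⟩
    rcases hk with hk | hk
    · rw [hk, hsa]
    · rw [hk, hsa]; ring
  have hae : ∀ᵐ t : ℝ, t ∉ {t | c t = 0} := ((countable_range _).mono hzero).ae_notMem _
  have h1 : ∫ t in (0 : ℝ)..2 * τ, f ‖flow f t (momentum c v 0)‖ = ∫ t in (0 : ℝ)..2 * τ, κ t := by
    refine intervalIntegral.integral_congr_ae ?_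
    filter_upwards [hae] with t ht _
    rw [h.flow_eq, h.norm_momentum (mem_univ t), h.curvature_eq t ht]
  rw [h.period_eq ho, h1]
  have h2 := ho.curvature_periodic.intervalIntegral_add_eq 0 a
  rw [zero_add] at h2
  rw [h2]
  have h3 := ho.tangentAngle_add_period a
  rw [tangentAngle_self, zero_add] at h3
  exact h3

theorem netWinding_eq (h : IsSolutionArc f κ c v) (ho : IsOscillating κ c v a τ) :
    netWinding f (momentum c v 0)
      = Real.sign (∫ t in (0 : ℝ)..2 * τ, κ t * (momentum c v t).im ^ 2)
        * (tangentAngle κ a (a + τ) / Real.pi) := by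
  rw [netWinding, h.signedArea_eq ho, h.integral_norm_flow_eq ho]
  field_simp

end IsSolutionArc

theorem IsConvexOscillating.integral_curvature_mul_sq_pos {κ : ℝ → ℝ} {c v : ℝ → ℂ} {a τ : ℝ}
    (h : IsConvexOscillating κ c v a τ) :
    0 < ∫ t in (0 : ℝ)..2 * τ, κ t * (momentum c v t).im ^ 2 := by
  have hτ := h.pos
  have hper : Function.Periodic (fun t => κ t * (momentum c v t).im ^ 2) (2 * τ) := fun t => by
    simp only [h.curvature_periodic t, h.momentum_periodic t]
  have h2 := hper.intervalIntegral_add_eq 0 a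
  rw [zero_add] at h2
  rw [h2]
  have hyc := Complex.continuous_im.comp h.continuous_momentum
  have hmid : a + τ / 2 ∈ Ioo a (a + τ) := ⟨by linarith, by linarith⟩
  refine intervalIntegral.integral_pos (by linarith)
    (h.continuous.mul (hyc.pow 2)).continuousOn
    (fun t _ => mul_nonneg (h.curvature_nonneg t) (sq_nonneg _))
    ⟨a + τ / 2, ⟨by linarith, by linarith⟩, ?_⟩
  exact mul_pos (h.curvature_pos_Ioc ⟨hmid.1, hmid.2.le⟩) (sq_pos_of_ne_zero (h.im_neg _ hmid).ne)

/-! ### Monotone curvature laws -/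

theorem pos_or_neg_of_ne_zero {f : ℝ → ℝ} (hf : ContDiffOn ℝ ∞ f (Ioi 0))
    (h0 : ∀ s : ℝ, 0 < s → f s ≠ 0) : (∀ s, 0 < s → 0 < f s) ∨ ∀ s, 0 < s → f s < 0 := by
  by_contra hcon
  push Not at hcon
  obtain ⟨⟨s, hs, hs0⟩, ⟨t, ht, ht0⟩⟩ := hcon
  obtain ⟨x, hx, hx0⟩ := isPreconnected_Ioi.intermediate_value (show s ∈ Ioi (0 : ℝ) from hs)
    (show t ∈ Ioi (0 : ℝ) from ht) hf.continuousOn (show (0 : ℝ) ∈ Icc _ _ from ⟨hs0, ht0⟩)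
  exact h0 x hx hx0

theorem strictMonoOn_or_strictAntiOn_of_deriv_ne_zero {f : ℝ → ℝ}
    (hf : ContDiffOn ℝ ∞ f (Ioi 0)) (h0 : ∀ s : ℝ, 0 < s → deriv f s ≠ 0) :
    StrictMonoOn f (Ioi 0) ∨ StrictAntiOn f (Ioi 0) := by
  rcases pos_or_neg_of_ne_zero (hf.deriv_of_isOpen isOpen_Ioi (by simp)) h0 with h | h
  · left
    exact strictMonoOn_of_deriv_pos (convex_Ioi 0) hf.continuousOn fun s hs =>
      h s (by rwa [interior_Ioi] at hs)
  · right
    exact strictAntiOn_of_deriv_neg (convex_Ioi 0) hf.continuousOn fun s hs =>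
      h s (by rwa [interior_Ioi] at hs)

theorem IsOscillating.curvature_mono_or_anti {f κ : ℝ → ℝ} {c v : ℝ → ℂ} {a τ : ℝ}
    (ho : IsOscillating κ c v a τ) (hκ : ∀ t, c t ≠ 0 → κ t = f ‖c t‖)
    (hf : StrictMonoOn f (Ioi 0) ∨ StrictAntiOn f (Ioi 0)) :
    StrictMonoOn κ (Ioo a (a + τ)) ∨ StrictAntiOn κ (Ioo a (a + τ)) := by
  have hne : ∀ t ∈ Ioo a (a + τ), c t ≠ 0 := fun t ht h0 =>
    ho.momentum_ne_zero ⟨ht.1, ht.2.le⟩ ((ho.momentum_eq_zero_iff (mem_univ t)).mpr h0)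
  have hr : ∀ s ∈ Ioo a (a + τ), ∀ t ∈ Ioo a (a + τ), s < t → ‖c s‖ < ‖c t‖ := fun s hs t ht hst =>
    ho.norm_strictMonoOn ⟨hs.1.le, hs.2.le⟩ ⟨ht.1.le, ht.2.le⟩ hst
  rcases hf with hf | hf
  · left
    intro s hs t ht hst
    rw [hκ s (hne s hs), hκ t (hne t ht)]
    exact hf (norm_pos_iff.mpr (hne s hs)) (norm_pos_iff.mpr (hne t ht)) (hr s hs t ht hst)
  · right
    intro s hs t ht hst
    rw [hκ s (hne s hs), hκ t (hne t ht)]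
    exact hf (norm_pos_iff.mpr (hne s hs)) (norm_pos_iff.mpr (hne t ht)) (hr s hs t ht hst)

/-- An oscillating solution, or its mirror image if `f < 0`, is a convex oscillating arc whose
half-period turning is `π` times the net winding. -/
theorem IsSolutionArc.exists_convex {f κ : ℝ → ℝ} {c v : ℝ → ℂ} {a τ : ℝ}
    (h : IsSolutionArc f κ c v) (ho : IsOscillating κ c v a τ)
    (hsign : (∀ s, 0 < s → 0 < f s) ∨ ∀ s, 0 < s → f s < 0)
    (hf : StrictMonoOn f (Ioi 0) ∨ StrictAntiOn f (Ioi 0)) :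
    ∃ (κ' : ℝ → ℝ) (c' v' : ℝ → ℂ) (ε : ℝ), ε ≠ 0 ∧ IsConvexOscillating κ' c' v' a τ ∧
      Nonempty (range c' ≃ₜ range c) ∧
      netWinding f (momentum c v 0) = tangentAngle κ' a (a + τ) / Real.pi ∧
      ∀ t, (momentum c' v' t).re = ε * (momentum c v t).re := by
  have hmono := ho.curvature_mono_or_anti h.curvature_eq hf
  rcases hsign with hpos | hneg
  · have hconv : IsConvexOscillating κ c v a τ :=
      { ho with
        curvature_pos := fun t ht => by
          rw [h.curvature_eq t ht]; exact hpos _ (norm_pos_iff.mpr ht)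
        curvature_mono := hmono }
    refine ⟨κ, c, v, 1, one_ne_zero, hconv, ⟨Homeomorph.refl _⟩, ?_, fun t => (one_mul _).symm⟩
    rw [h.netWinding_eq ho, Real.sign_of_pos hconv.integral_curvature_mul_sq_pos, one_mul]
  · have hconv : IsConvexOscillating (fun t => -κ t) (fun t => starRingEnd ℂ (c t))
        (fun t => starRingEnd ℂ (v t)) a τ :=
      { ho.reflect_conj with
        curvature_pos := fun t ht => by
          have ht' : c t ≠ 0 := fun h0 => ht (by rw [h0, map_zero])
          rw [h.curvature_eq t ht']
          linarith [hneg _ (norm_pos_iff.mpr ht')]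
        curvature_mono := hmono.symm.imp (fun hm => hm.neg) fun hm => hm.neg }
    have hm : ∀ t, momentum (fun t => starRingEnd ℂ (c t)) (fun t => starRingEnd ℂ (v t)) t
        = -starRingEnd ℂ (momentum c v t) := by
      intro t; simp [momentum]
    refine ⟨_, _, _, -1, by norm_num, hconv, ?_, ?_, fun t => by rw [hm]; simp⟩
    · have himg : range (fun t => starRingEnd ℂ (c t)) = Complex.conjLIE.toHomeomorph '' range c := by
        rw [← range_comp]; rfl
      rw [himg]
      exact ⟨(Complex.conjLIE.toHomeomorph.image (range c)).symm⟩
    · have hint := hconv.integral_curvature_mul_sq_pos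
      have e1 : ∀ t, -κ t * (momentum (fun t => starRingEnd ℂ (c t))
          (fun t => starRingEnd ℂ (v t)) t).im ^ 2 = -(κ t * (momentum c v t).im ^ 2) := by
        intro t; rw [hm]; simp
      simp only [e1] at hint
      rw [intervalIntegral.integral_neg] at hint
      have e2 : tangentAngle (fun t => -κ t) a (a + τ) = -tangentAngle κ a (a + τ) := by
        simp only [tangentAngle]; rw [intervalIntegral.integral_neg]
      rw [h.netWinding_eq ho, Real.sign_of_neg (by linarith), e2]
      ring

/-! ### Closed solutions -/

namespace UnitSpeedPath

variable {c : UnitSpeedPath} {f : ℝ → ℝ}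

/-- On a closed curve the distance from the origin attains its extrema at times in `J`. So it is
either constant, or there are two consecutive critical times. -/
theorem IsClosedCurve.norm_const_or_exists_critical (hclosed : c.IsClosedCurve) :
    (∃ ρ : ℝ, 0 < ρ ∧ ∀ t ∈ c.J, ‖c.toFun t‖ = ρ) ∨
      ∃ a ∈ c.J, ∃ b ∈ c.J, a < b ∧ (c.assoc a).im = 0 ∧ (c.assoc b).im = 0 ∧
        ∀ t ∈ Ioo a b, (c.assoc t).im ≠ 0 := by
  have hne : c.trace.Nonempty := ⟨_, 0, c.zero_mem, rfl⟩
  obtain ⟨_, ⟨t₀, ht₀, rfl⟩, hmax⟩ :=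
    IsCompact.exists_isMaxOn hclosed hne continuous_norm.continuousOn
  obtain ⟨_, ⟨t₁, ht₁, rfl⟩, hmin⟩ :=
    IsCompact.exists_isMinOn hclosed hne continuous_norm.continuousOn
  have hmax' : ∀ t ∈ c.J, ‖c.toFun t‖ ≤ ‖c.toFun t₀‖ := fun t ht => hmax ⟨t, ht, rfl⟩
  have hmin' : ∀ t ∈ c.J, ‖c.toFun t₁‖ ≤ ‖c.toFun t‖ := fun t ht => hmin ⟨t, ht, rfl⟩
  have hcrit₀ : (c.assoc t₀).im = 0 := by
    have hext : IsLocalMax (fun t => ‖c.toFun t‖ ^ 2) t₀ := by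
      filter_upwards [c.isOpen_J.mem_nhds ht₀] with t ht
      exact pow_le_pow_left₀ (norm_nonneg _) (hmax' t ht) 2
    have := hext.hasDerivAt_eq_zero (c.isArc.hasDerivAt_norm_sq ht₀)
    rw [← c.assoc_eq_momentum] at this
    linarith
  have hcrit₁ : (c.assoc t₁).im = 0 := by
    have hext : IsLocalMin (fun t => ‖c.toFun t‖ ^ 2) t₁ := by
      filter_upwards [c.isOpen_J.mem_nhds ht₁] with t ht
      exact pow_le_pow_left₀ (norm_nonneg _) (hmin' t ht) 2
    have := hext.hasDerivAt_eq_zero (c.isArc.hasDerivAt_norm_sq ht₁)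
    rw [← c.assoc_eq_momentum] at this
    linarith
  by_cases heq : ‖c.toFun t₀‖ = ‖c.toFun t₁‖
  · left
    have hconst : ∀ t ∈ c.J, ‖c.toFun t‖ = ‖c.toFun t₀‖ := fun t ht =>
      le_antisymm (hmax' t ht) (heq ▸ hmin' t ht)
    refine ⟨‖c.toFun t₀‖, ?_, hconst⟩
    have hJ : ∀ᶠ t in 𝓝[≠] (0 : ℝ), t ∈ c.J :=
      nhdsWithin_le_nhds (c.isOpen_J.mem_nhds c.zero_mem)
    obtain ⟨t, ht, htJ⟩ := ((c.isArc.eventually_ne_zero c.zero_mem).and hJ).exists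
    rw [← hconst t htJ]
    exact norm_pos_iff.mpr ht
  right
  have key : ∀ p ∈ c.J, ∀ q ∈ c.J, p < q → (c.assoc p).im = 0 → (c.assoc q).im = 0 →
      ‖c.toFun p‖ ≠ ‖c.toFun q‖ → ∃ a ∈ c.J, ∃ b ∈ c.J, a < b ∧ (c.assoc a).im = 0 ∧
        (c.assoc b).im = 0 ∧ ∀ t ∈ Ioo a b, (c.assoc t).im ≠ 0 := by
    intro p hp q hq hpq hp0 hq0 hnpq
    have hsub : Icc p q ⊆ c.J := c.ordConnected_J.out hp hq
    have hcont : ContinuousOn (fun t => (c.assoc t).im) (Icc p q) := fun t ht =>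
      (hasDerivAt_im (c.isArc.hasDerivAt_momentum (hsub ht))).continuousAt.continuousWithinAt
    have hex : ∃ t ∈ Icc p q, (c.assoc t).im ≠ 0 := by
      by_contra hcon
      push Not at hcon
      have hconst : ‖c.toFun q‖ ^ 2 = ‖c.toFun p‖ ^ 2 := by
        refine constant_of_has_deriv_right_zero (f := fun t => ‖c.toFun t‖ ^ 2) (fun t ht =>
          (c.isArc.hasDerivAt_norm_sq (hsub ht)).continuousAt.continuousWithinAt) (fun t ht => ?_)
          q ⟨hpq.le, le_rfl⟩
        have := (c.isArc.hasDerivAt_norm_sq (hsub ⟨ht.1, ht.2.le⟩)).hasDerivWithinAt (s := Ici t)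
        rw [← c.assoc_eq_momentum, hcon t ⟨ht.1, ht.2.le⟩, mul_zero] at this
        exact this
      exact hnpq ((pow_left_inj₀ (norm_nonneg _) (norm_nonneg _) two_ne_zero).mp hconst).symm
    obtain ⟨t, ht, ht0⟩ := hex
    obtain ⟨a, ha, ha0, ha'⟩ := exists_last_zero ht.1
      (hcont.mono (Icc_subset_Icc le_rfl ht.2)) hp0 ht0
    obtain ⟨b, hb, hb0, hb'⟩ := exists_first_zero ht.2
      (hcont.mono (Icc_subset_Icc ht.1 le_rfl)) ht0 hq0
    refine ⟨a, hsub ⟨ha.1, ha.2.le.trans ht.2⟩, b, hsub ⟨ht.1.trans hb.1.le, hb.2⟩,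
      ha.2.trans hb.1, ha0, hb0, fun s hs => ?_⟩
    rcases le_total s t with h | h
    · exact ha' s ⟨hs.1, h⟩
    · exact hb' s ⟨h, hs.2⟩
  rcases lt_trichotomy t₀ t₁ with h | h | h
  · exact key t₀ ht₀ t₁ ht₁ h hcrit₀ hcrit₁ heq
  · exact absurd (by rw [h]) heq
  · exact key t₁ ht₁ t₀ ht₀ h hcrit₁ hcrit₀ (Ne.symm heq)

theorem contDiff_of_isArc {κ : ℝ → ℝ} {γ v : ℝ → ℂ} (h : IsArc univ κ γ v)
    (hκ : ContDiff ℝ ∞ κ) : ContDiff ℝ ∞ γ := by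
  have hv : ContDiff ℝ ∞ v := by
    rw [contDiff_infty]
    intro n
    induction n with
    | zero => exact contDiff_zero.mpr (continuous_iff_continuousAt.mpr fun t =>
        (h.hasDerivAt_tangent t (mem_univ t)).continuousAt)
    | succ n ih =>
      rw [Nat.cast_succ, contDiff_succ_iff_deriv]
      refine ⟨fun t => (h.hasDerivAt_tangent t (mem_univ t)).differentiableAt, by simp, ?_⟩
      have e : deriv v = fun t => I * κ t * v t :=
        funext fun t => (h.hasDerivAt_tangent t (mem_univ t)).deriv
      rw [e]
      exact (contDiff_const.mul (Complex.ofRealCLM.contDiff.comp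
        (hκ.of_le (by exact_mod_cast le_top)))).mul ih
  rw [contDiff_infty_iff_deriv]
  refine ⟨fun t => (h.hasDerivAt t (mem_univ t)).differentiableAt, ?_⟩
  rw [show deriv γ = v from funext fun t => (h.hasDerivAt t (mem_univ t)).deriv]
  exact hv

/-- A complete arc with smooth curvature, as a path on the whole line. -/
def ofArc {κ : ℝ → ℝ} {γ v : ℝ → ℂ} (h : IsArc univ κ γ v) (hκ : ContDiff ℝ ∞ κ) :
    UnitSpeedPath where
  J := univ
  toFun := γ
  isOpen_J := isOpen_univ
  ordConnected_J := ordConnected_univ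
  zero_mem := mem_univ 0
  smooth := (contDiff_of_isArc h hκ).contDiffOn
  unit_speed t _ := by rw [(h.hasDerivAt t (mem_univ t)).deriv]; exact h.norm_tangent t (mem_univ t)

theorem trace_ofArc {κ : ℝ → ℝ} {γ v : ℝ → ℂ} (h : IsArc univ κ γ v) (hκ : ContDiff ℝ ∞ κ) :
    (ofArc h hκ).trace = range γ := image_univ

theorem isSolution_ofArc {κ : ℝ → ℝ} {γ v : ℝ → ℂ} (h : IsArc univ κ γ v) (hκ : ContDiff ℝ ∞ κ)
    (hf : ∀ t, γ t ≠ 0 → κ t = f ‖γ t‖) : (ofArc h hκ).IsSolution f := by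
  intro t _ ht
  have hd : deriv γ = v := funext fun t => (h.hasDerivAt t (mem_univ t)).deriv
  rw [← show κ t = f ‖(ofArc h hκ).toFun t‖ from hf t ht]
  change (starRingEnd ℂ (deriv γ t) * deriv (deriv γ) t).im = κ t
  rw [hd, (h.hasDerivAt_tangent t (mem_univ t)).deriv,
    show starRingEnd ℂ (v t) * (I * κ t * v t) = (starRingEnd ℂ (v t) * v t) * (I * κ t) by ring,
    h.conj_mul_tangent (mem_univ t)]
  simp

/-- A maximal solution with two consecutive critical times has the same trace as an oscillating
solution on the whole line that extends it. -/
theorem IsMaximalSolution.exists_oscillating (hmax : c.IsMaximalSolution f)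
    (hf : ContDiffOn ℝ ∞ f (Ioi 0)) {a b : ℝ} (ha : a ∈ c.J) (hb : b ∈ c.J) (hab : a < b)
    (haz : (c.assoc a).im = 0) (hbz : (c.assoc b).im = 0)
    (hne : ∀ t ∈ Ioo a b, (c.assoc t).im ≠ 0) :
    ∃ (κ : ℝ → ℝ) (γ v : ℝ → ℂ) (a' τ : ℝ), IsOscillating κ γ v a' τ ∧ IsSolutionArc f κ γ v ∧
      c.trace = range γ ∧ c.assoc 0 = momentum γ v 0 := by
  obtain ⟨κ, γ, v, a', τ, ho, hκ, hκf, hγ, hv⟩ :=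
    hmax.1.exists_oscillating_extension hf ha hb hab haz hbz hne
  have hsol := isSolution_ofArc ho.toIsArc hκ hκf
  refine ⟨κ, γ, v, a', τ, ho, { ho.toIsArc with curvature_eq := hκf, lipNear := fun t => ?_ }, ?_,
    ?_⟩
  · have := hsol.lipNear hf (mem_univ t)
    rwa [assoc_eq_momentum, show (ofArc ho.toIsArc hκ).toFun = γ from rfl,
      show deriv γ = v from funext fun t => (ho.hasDerivAt t (mem_univ t)).deriv] at this
  · rw [← trace_ofArc ho.toIsArc hκ]
    refine hmax.2 _ hsol ?_
    rw [trace_ofArc]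
    rintro _ ⟨t, ht, rfl⟩
    exact ⟨t, hγ ht⟩
  · rw [assoc_eq_momentum, momentum, momentum, hγ c.zero_mem, hv c.zero_mem]

/-! ### Circles centred at the origin -/

/-- Along a solution at constant distance from the origin the momentum is a constant point of
`fixedSet f`. -/
theorem IsSolution.exists_fixed_of_norm_const (hc : c.IsSolution f) {ρ : ℝ} (hρ : 0 < ρ)
    (hn : ∀ t ∈ c.J, ‖c.toFun t‖ = ρ) :
    ∃ x : ℝ, x * f ρ = 1 ∧ |x| = ρ ∧ ∀ t ∈ c.J, c.assoc t = x := by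
  have him : ∀ t ∈ c.J, (c.assoc t).im = 0 := by
    intro t ht
    have h1 : HasDerivAt (fun t => ‖c.toFun t‖ ^ 2) 0 t := by
      refine (hasDerivAt_const t (ρ ^ 2)).congr_of_eventuallyEq ?_
      filter_upwards [c.isOpen_J.mem_nhds ht] with s hs
      rw [hn s hs]
    have := (c.isArc.hasDerivAt_norm_sq ht).unique h1
    rw [← c.assoc_eq_momentum] at this
    linarith
  have hre : ∀ t ∈ c.J, (c.assoc t).re * f ρ = 1 := by
    intro t ht
    have h1 : HasDerivAt (fun t => (c.assoc t).im) 0 t := by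
      refine (hasDerivAt_const t (0 : ℝ)).congr_of_eventuallyEq ?_
      filter_upwards [c.isOpen_J.mem_nhds ht] with s hs
      rw [him s hs]
    have h2 := (c.isArc.hasDerivAt_momentum_im ht).unique h1
    have h3 : c.toFun t ≠ 0 := by rw [← norm_pos_iff, hn t ht]; exact hρ
    rw [← c.assoc_eq_momentum, hc t ht h3, hn t ht] at h2
    linarith
  have hf0 : f ρ ≠ 0 := fun h0 => by
    have := hre 0 c.zero_mem
    rw [h0, mul_zero] at this
    exact zero_ne_one this
  have hx : ∀ t ∈ c.J, c.assoc t = ((f ρ)⁻¹ : ℝ) := fun t ht =>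
    Complex.ext (by rw [ofReal_re]; exact eq_inv_of_mul_eq_one_left (hre t ht))
      (by rw [ofReal_im]; exact him t ht)
  refine ⟨(f ρ)⁻¹, inv_mul_cancel₀ hf0, ?_, hx⟩
  have := c.isArc.norm_momentum c.zero_mem
  rwa [hn 0 c.zero_mem, ← c.assoc_eq_momentum, hx 0 c.zero_mem, norm_real, Real.norm_eq_abs] at this

/-- A maximal solution at constant distance from the origin is a full circle. -/
theorem IsMaximalSolution.trace_eq_sphere (hmax : c.IsMaximalSolution f) {ρ : ℝ} (hρ : 0 < ρ)
    (hn : ∀ t ∈ c.J, ‖c.toFun t‖ = ρ) : c.trace = Metric.sphere 0 ρ := by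
  obtain ⟨x, hx, hxρ, -⟩ := hmax.1.exists_fixed_of_norm_const hρ hn
  set γ : ℝ → ℂ := fun t => ρ * exp ((f ρ * t : ℝ) * I) with hγ
  set v : ℝ → ℂ := fun t => I * f ρ * γ t with hv
  have hγn : ∀ t, ‖γ t‖ = ρ := fun t => by
    rw [hγ, norm_mul, Complex.norm_exp_ofReal_mul_I, norm_real, Real.norm_eq_abs, abs_of_pos hρ,
      mul_one]
  have hγd : ∀ t, HasDerivAt γ (v t) t := by
    intro t
    have h1 : HasDerivAt (fun t : ℝ => exp ((f ρ * t : ℝ) * I)) _ t :=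
      ((((hasDerivAt_id t).const_mul (f ρ)).ofReal_comp).mul_const I).cexp
    refine (h1.const_mul (ρ : ℂ)).congr_deriv ?_
    simp only [hv, hγ, id]
    push_cast
    ring
  have harc : IsArc univ (fun _ => f ρ) γ v :=
    { hasDerivAt := fun t _ => hγd t
      hasDerivAt_tangent := fun t _ => (hγd t).const_mul _
      norm_tangent := fun t _ => by
        have h1 := congrArg abs hx
        rw [abs_mul, hxρ, abs_one] at h1
        rw [hv, norm_mul, norm_mul, norm_I, one_mul, hγn, norm_real, Real.norm_eq_abs, mul_comm,
          h1] }
  have hrange : range γ = Metric.sphere 0 ρ := by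
    have hf0 : f ρ ≠ 0 := fun h0 => by rw [h0, mul_zero] at hx; exact zero_ne_one hx
    ext p
    rw [mem_sphere_zero_iff_norm]
    constructor
    · rintro ⟨t, rfl⟩; exact hγn t
    · intro hp
      refine ⟨p.arg / f ρ, ?_⟩
      rw [hγ]
      simp only [mul_div_cancel₀ _ hf0]
      rw [← hp, Complex.norm_mul_exp_arg_mul_I]
  have hsol := isSolution_ofArc (f := f) harc contDiff_const fun t _ => by rw [hγn]
  rw [← hrange, ← trace_ofArc harc contDiff_const]
  refine hmax.2 _ hsol ?_
  rw [trace_ofArc, hrange]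
  rintro _ ⟨t, ht, rfl⟩
  rw [mem_sphere_zero_iff_norm, hn t ht]

end UnitSpeedPath

theorem sphere_homeomorph_circle {ρ : ℝ} (hρ : 0 < ρ) :
    Nonempty (Metric.sphere (0 : ℂ) ρ ≃ₜ Circle) := by
  have hρ' : (ρ : ℂ) ≠ 0 := ofReal_ne_zero.mpr hρ.ne'
  refine ⟨{ toFun := fun p => ⟨p.1 / ρ, ?_⟩
            invFun := fun w => ⟨ρ * w, ?_⟩
            left_inv := fun p => Subtype.ext (mul_div_cancel₀ _ hρ')
            right_inv := fun w => Circle.ext (mul_div_cancel_left₀ _ hρ')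
            continuous_toFun := ?_
            continuous_invFun := ?_ }⟩
  · have := p.2
    rw [mem_sphere_zero_iff_norm] at this
    change p.1 / (ρ : ℂ) ∈ Metric.sphere (0 : ℂ) 1
    rw [mem_sphere_zero_iff_norm, norm_div, this, norm_real, Real.norm_eq_abs, abs_of_pos hρ,
      div_self hρ.ne']
  · rw [mem_sphere_zero_iff_norm, norm_mul, norm_real, Circle.norm_coe, mul_one, Real.norm_eq_abs,
      abs_of_pos hρ]
  · exact Continuous.subtype_mk (continuous_subtype_val.div_const _) _
  · exact Continuous.subtype_mk (continuous_const.mul continuous_subtype_val) _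

/-- A point of `fixedSet f` is a fixed point of the flow. -/
theorem flow_of_mem_fixedSet {f : ℝ → ℝ} (hf : ContDiffOn ℝ ∞ f (Ioi 0)) {p : ℂ}
    (hp : p ∈ fixedSet f) (t : ℝ) : flow f t p = p := by
  have hfield : field f p = 0 := by
    rw [field, mul_assoc, hp.2, mul_one, sub_self]
  have hd : ∀ t : ℝ, HasDerivAt (fun _ : ℝ => p) (field f p) t := fun t => by
    rw [hfield]; exact hasDerivAt_const t p
  refine flow_eq_of_integralCurve (z := fun _ => p) hd
    (fun _ => lipNear_field_of_ne_zero hf hp.1)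
    ⟨continuous_const, fun t _ => hd t, ?_⟩ t
  simp [hp.1]

theorem period_of_mem_fixedSet {f : ℝ → ℝ} (hf : ContDiffOn ℝ ∞ f (Ioi 0)) {p : ℂ}
    (hp : p ∈ fixedSet f) : period f p = 0 := by
  have : {t : ℝ | 0 < t ∧ flow f t p = p} = Ioi 0 := by
    ext t; simp [flow_of_mem_fixedSet hf hp]
  rw [period, this, csInf_Ioi]

end RadialCurvature

end

theorem mainTheorem3 (f : ℝ → ℝ) (hf : ContDiffOn ℝ ∞ f (Set.Ioi 0))
    (hff' : ∀ s : ℝ, 0 < s → f s * deriv f s ≠ 0)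
    (c : RadialCurvature.UnitSpeedPath) (hmax : c.IsMaximalSolution f)
    (hclosed : c.IsClosedCurve) :
    ((RadialCurvature.Untwisted f (c.assoc 0) ∧
        (RadialCurvature.netWinding f (c.assoc 0) = 0 ∨
          ∃ n : ℕ, 2 ≤ n ∧ RadialCurvature.netWinding f (c.assoc 0) = 1 / (n : ℝ))) ↔
      c.IsJordanSolution f) ∧
    (RadialCurvature.netWinding f (c.assoc 0) = 0 ↔
      ∃ z ∈ RadialCurvature.fixedSet f,
        c.trace = Metric.sphere (0 : ℂ) ‖z‖ ∧
        (0 < z.re → c.IsCounterClockwise) ∧ (z.re < 0 → c.IsClockwise)) := by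
  open RadialCurvature in
  rcases hclosed.norm_const_or_exists_critical with
    ⟨ρ, hρ, hn⟩ | ⟨a, ha, b, hb, hab, haz, hbz, hne⟩
  · obtain ⟨x, hx, hxρ, hxJ⟩ := hmax.1.exists_fixed_of_norm_const hρ hn
    have htrace := hmax.trace_eq_sphere hρ hn
    have hnx : ‖(x : ℂ)‖ = ρ := by rw [Complex.norm_real, Real.norm_eq_abs, hxρ]
    have hx0 : x ≠ 0 := fun h0 => by rw [h0, zero_mul] at hx; exact zero_ne_one hx
    have hfix : (x : ℂ) ∈ fixedSet f :=
      ⟨Complex.ofReal_ne_zero.mpr hx0, by rw [hnx, ← Complex.ofReal_mul, hx, Complex.ofReal_one]⟩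
    have hflow := flow_of_mem_fixedSet hf hfix
    rw [hxJ 0 c.zero_mem]
    have hw : netWinding f x = 0 := by
      rw [netWinding, period_of_mem_fixedSet hf hfix]; simp
    have hu : Untwisted f x := by
      refine untwisted_of_re_pos ⟨1, one_pos, hflow 1⟩ (ε := x) hx0 fun t => ?_
      rw [hflow, Complex.ofReal_re]
      exact mul_self_pos.mpr hx0
    have horient : ∀ t ∈ c.J,
        (starRingEnd ℂ (c.toFun t) * deriv c.toFun t).im = x := by
      intro t ht
      have := congrArg Complex.re (hxJ t ht)
      simp [UnitSpeedPath.assoc] at this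
      simp
      linarith
    refine ⟨⟨fun _ => ⟨hmax, ?_⟩, fun _ => ⟨hu, Or.inl hw⟩⟩, fun _ => ⟨x, hfix, ?_, ?_, ?_⟩,
      fun _ => hw⟩
    · rw [UnitSpeedPath.IsSimpleClosed, htrace]
      exact sphere_homeomorph_circle hρ
    · rw [htrace, hnx]
    · intro h t ht
      rw [horient t ht]
      simpa using h
    · intro h t ht
      rw [horient t ht]
      simpa using h
  · obtain ⟨κ, γ, v, a', τ, ho, hsol, htrace, hassoc⟩ :=
      hmax.exists_oscillating hf ha hb hab haz hbz hne
    obtain ⟨κ', γ', v', ε, hε, hconv, ⟨Ψ⟩, hwind, hre⟩ := hsol.exists_convex ho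
      (pos_or_neg_of_ne_zero hf fun s hs => left_ne_zero_of_mul (hff' s hs))
      (strictMonoOn_or_strictAntiOn_of_deriv_ne_zero hf fun s hs =>
        right_ne_zero_of_mul (hff' s hs))
    have hpos := hconv.tangentAngle_half_pos
    have hw0 : netWinding f (c.assoc 0) ≠ 0 := by
      rw [hassoc, hwind]
      exact (div_pos hpos Real.pi_pos).ne'
    have hnorm := ho.norm_strictMonoOn ⟨le_rfl, by linarith [ho.pos]⟩
      ⟨by linarith [ho.pos], le_rfl⟩ (show a' < a' + τ by linarith [ho.pos])
    refine ⟨⟨?_, ?_⟩, fun h => absurd h hw0, ?_⟩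
    · rintro ⟨-, h0 | ⟨n, hn, hwn⟩⟩
      · exact absurd h0 hw0
      · refine ⟨hmax, ?_⟩
        rw [hassoc, hwind] at hwn
        have hn0 : (n : ℝ) ≠ 0 := by positivity
        obtain ⟨Ξ⟩ := hconv.range_homeomorph_circle (n := n) (by
          field_simp at hwn
          linarith)
        rw [UnitSpeedPath.IsSimpleClosed, htrace]
        exact ⟨Ψ.symm.trans Ξ⟩
    · rintro ⟨-, hS⟩
      rw [UnitSpeedPath.IsSimpleClosed, htrace] at hS
      obtain ⟨Ξ⟩ := hS
      obtain ⟨hrepos, n, hn, hnβ⟩ := hconv.of_range_homeomorph_circle ⟨Ψ.trans Ξ⟩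
      rw [hassoc]
      refine ⟨untwisted_of_re_pos (hsol.mem_Per ho) hε fun t => ?_, Or.inr ⟨n, hn, ?_⟩⟩
      · rw [hsol.flow_eq, ← hre]; exact hrepos t
      · have hn0 : (n : ℝ) ≠ 0 := by positivity
        rw [hwind, ← hnβ]
        field_simp
    · rintro ⟨z, -, hsphere, -⟩
      rw [htrace] at hsphere
      have h1 : ∀ t, ‖γ t‖ = ‖z‖ := fun t => by
        rw [← mem_sphere_zero_iff_norm, ← hsphere]; exact Set.mem_range_self t
      simp only [h1, lt_irrefl] at hnorm
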